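/- Let $d\ge 2$ be an integer. For $x,\xi\in[0,\infty)$ with base-$d$ expansions $x=\sum_{n\in\mathbb Z}x_nd^n$ and $\xi=\sum_{n\in\mathbb Z}\xi_nd^n$, digits in $\{0,\dots,d-1\}$ (the terminating expansion is taken when there are two), let $$E_d(x,\xi)=\exp\Big(\frac{2\pi i}{d}\sum_{n\in\mathbb Z}x_n\,\xi_{-1-n}\Big).$$ For a compactly supported integrable function $f\colon[0,\infty)\to\mathbb C$ and $\xi\in[0,\infty)$ consider the initial value problem $$\frac{\partial}{\partial x}G(x,\xi)=G(x,\xi)\begin{bmatrix}0&\overline{f(x)E_d(x,\xi)}\\ f(x)E_d(x,\xi)&0\end{bmatrix}\ \text{ for a.e. }x\ge 0,\qquad G(0,\xi)=\begin{bmatrix}1&0\\0&1\end{bmatrix},$$ for matrices $G(x,\xi)=\begin{bmatrix}a(x,\xi)&\overline{b(x,\xi)}\\ b(x,\xi)&\overline{a(x,\xi)}\end{bmatrix}$ whose entries are locally absolutely continuous in $x\in[0,\infty)$. For every $\xi\in[0,\infty)$ the limit $$G(\xi)=\begin{bmatrix}a(\xi)&\overline{b(\xi)}\\ b(\xi)&\overline{a(\xi)}\end{bmatrix}=\lim_{x\to\infty}G(x,\xi)$$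 of a solution exists, does not depend on the solution, and lies in $$\mathrm{SU}(1,1)=\Big\{\begin{bmatrix}a&\overline b\\ b&\overline a\end{bmatrix}:\ a,b\in\mathbb C,\ |a|^2-|b|^2=1\Big\};$$ the function $\xi\mapsto G(\xi)$ is called the Cantor group model Dirac scattering transform of $f$. Moreover, there is a constant $C_d>0$, depending only on $d$, such that for all conjugate exponents $1\le p\le 2$, $2\le q\le\infty$, $\frac1p+\frac1q=1$, and every compactly supported integrable $f\colon[0,\infty)\to\mathbb C$, the function $\xi\mapsto(\ln|a(\xi)|)^{1/2}$ is measurable on $[0,\infty)$ and $$\big\|(\ln|a(\xi)|)^{1/2}\big\|_{L^q_\xi([0,\infty))}\le C_d\,\|f\|_{L^p([0,\infty))}.$$ The right-hand side may be $+\infty$. -/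

import Mathlib

open MeasureTheory Filter Topology Set
open scoped ENNReal ComplexConjugate

noncomputable section

/-- The base-`d` digit `x_n` (`n : ℤ`) of `x = ∑ x_n d ^ n ≥ 0`. For the countably many `x` with
two base-`d` expansions this selects the terminating one. -/
def baseDigit (d : ℕ) (x : ℝ) (n : ℤ) : ℕ :=
  ⌊x * (d : ℝ) ^ (-n)⌋₊ % d

/-- The sum `∑_{n ∈ ℤ} x_n ξ_{-1-n}`; it has finitely many nonzero terms by
`finite_support_baseDigit_mul`. -/
def digitPairing (d : ℕ) (x ξ : ℝ) : ℕ :=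
  ∑ᶠ n : ℤ, baseDigit d x n * baseDigit d ξ (-1 - n)

/-- The Cantor group character function
`E_d (x, ξ) = exp ((2 π i / d) ∑_{n ∈ ℤ} x_n ξ_{-1-n})`. -/
def cantorChar (d : ℕ) (x ξ : ℝ) : ℂ :=
  Complex.exp (2 * Real.pi * Complex.I / d * (digitPairing d x ξ : ℂ))

/-- The digits of index at least some `N` vanish. -/
theorem exists_baseDigit_eq_zero (d : ℕ) (hd : 2 ≤ d) (x : ℝ) :
    ∃ N : ℕ, ∀ n : ℤ, (N : ℤ) ≤ n → baseDigit d x n = 0 := by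
  have hd1 : (1 : ℝ) < d := by exact_mod_cast (by omega : 1 < d)
  obtain ⟨N, hN⟩ := pow_unbounded_of_one_lt x hd1
  refine ⟨N, fun n hn => ?_⟩
  have hlt : x * (d : ℝ) ^ (-n) < 1 := by
    have h1 : x < (d : ℝ) ^ n := by
      refine hN.trans_le ?_
      rw [← zpow_natCast]
      exact zpow_le_zpow_right₀ hd1.le hn
    have hpos : (0 : ℝ) < (d : ℝ) ^ n := by positivity
    rw [zpow_neg, ← div_eq_mul_inv, div_lt_one hpos]
    exact h1
  have : ⌊x * (d : ℝ) ^ (-n)⌋₊ = 0 := Nat.floor_eq_zero.2 hlt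
  rw [baseDigit, this, Nat.zero_mod]

theorem finite_support_baseDigit_mul (d : ℕ) (hd : 2 ≤ d) (x ξ : ℝ) :
    (Function.support fun n : ℤ => baseDigit d x n * baseDigit d ξ (-1 - n)).Finite := by
  obtain ⟨N, hN⟩ := exists_baseDigit_eq_zero d hd x
  obtain ⟨M, hM⟩ := exists_baseDigit_eq_zero d hd ξ
  refine (Set.finite_Icc (-1 - (M : ℤ)) N).subset fun n hn => ?_
  have hn' : baseDigit d x n ≠ 0 ∧ baseDigit d ξ (-1 - n) ≠ 0 := by
    simpa [Function.mem_support, not_or] using hn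
  constructor
  · by_contra h
    exact hn'.2 (hM _ (by omega))
  · by_contra h
    exact hn'.1 (hN _ (by omega))

/-- The matrix with rows `(a, conj b)` and `(b, conj a)`. -/
def su11Matrix (a b : ℂ) : Matrix (Fin 2) (Fin 2) ℂ :=
  !![a, conj b; b, conj a]

/-- The group `SU(1,1)`, as a set of matrices. -/
def SU11 : Set (Matrix (Fin 2) (Fin 2) ℂ) :=
  {G | ∃ a b : ℂ, ‖a‖ ^ 2 - ‖b‖ ^ 2 = 1 ∧ G = su11Matrix a b}

/-- The coefficient matrix `W (x, ξ)` of the initial value problem. -/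
def diracCoeff (d : ℕ) (f : ℝ → ℂ) (x ξ : ℝ) : Matrix (Fin 2) (Fin 2) ℂ :=
  !![0, conj (f x * cantorChar d x ξ); f x * cantorChar d x ξ, 0]

/-- `a` and `b` are the (locally absolutely continuous) entries of a solution
`G = su11Matrix a b` on `[0, ∞)` of `∂G/∂x = G W (x, ξ)` for almost every `x`, `G (0) = 1`. -/
structure IsDiracSolution (d : ℕ) (f : ℝ → ℂ) (ξ : ℝ) (a b : ℝ → ℂ) : Prop where
  initial : su11Matrix (a 0) (b 0) = 1
  absCont_a : ∀ R : ℝ, 0 ≤ R → AbsolutelyContinuousOnInterval a 0 R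
  absCont_b : ∀ R : ℝ, 0 ≤ R → AbsolutelyContinuousOnInterval b 0 R
  ode : ∀ᵐ x ∂(volume.restrict (Ici (0 : ℝ))), ∀ i j : Fin 2,
    HasDerivAt (fun y => su11Matrix (a y) (b y) i j)
      ((su11Matrix (a x) (b x) * diracCoeff d f x ξ) i j) x

/-- `G` is the value at `ξ` of the Cantor group model Dirac scattering transform of `f`: the limit
as `x → ∞` of a solution of the initial value problem. -/
def IsScatteringTransformAt (d : ℕ) (f : ℝ → ℂ) (ξ : ℝ) (G : Matrix (Fin 2) (Fin 2) ℂ) : Prop :=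
  ∃ a b : ℝ → ℂ, IsDiracSolution d f ξ a b ∧
    Tendsto (fun x => su11Matrix (a x) (b x)) atTop (𝓝 G)

/-- Integrable functions on `[0, ∞)` with compact support. The values of `f` at negative
arguments play no role anywhere. -/
structure IsCompactlySupportedIntegrable (f : ℝ → ℂ) : Prop where
  integrableOn : IntegrableOn f (Ici (0 : ℝ)) volume
  compactSupport : ∃ R : ℝ, ∀ x : ℝ, R ≤ x → f x = 0

end

/-! The estimate is an induction on scales in which no constant is lost. Pair `d`-adic intervals of
length `d ^ k` with frequencies `m d ^ (-k)`. Passing from `m` to its `j`-th child frequency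
multiplies the character on the `l`-th subinterval by the constant `ω ^ (j l)`, `ω = exp (2 π i /
d)`. Hence the data of an interval at the `d` child frequencies are products of the same `d`
matrices of SU(1,1), with off-diagonal entries rotated by `ω ^ (j l)` (`flowValue_child`).

In the linear model this is a Fourier transform on `ℤ / dℤ`, where Hausdorff–Young holds with
constant one, so it can be iterated. To keep constant one in the nonlinear setting, size is measured
by `(log (1 + c |b|²))^(1/2)` with `c` large in terms of `d`. Then `exists_nodeInequality` bounds
the squared size of a product by that of a trigonometric polynomial with coefficients `γ l`,
possibly smaller than the input sizes, plus the missing diagonal mass. Padding `γ l` with orthogonal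
vectors turns this into Hilbert-space-valued Hausdorff–Young (`sum_rpow_le_of_sq_le`).

Minkowski's inequality lets the node estimate climb the tree (`sum_rpow_le_of_forall_node`). At the
finest scale `d ^ (-N)` only frequency zero occurs, and the size is at most a constant times the L¹
norm of `f` on the cell (`tileSize_le_integral`); Hölder converts this to an Lᵖ norm. The powers of
`d` cancel, so the bound on frequencies in `[0, d ^ N)` is uniform in `N`, and `N → ∞` gives the
claim. Finally `|a| ≤ 1 + c |b|²`. The case `q = ∞` is the L¹ bound itself. Existence of solutions
is a weighted Picard iteration (`exists_isDiracFlow`). -/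

noncomputable section

/-! ### Absolutely continuous complex-valued functions. -/

namespace AbsolutelyContinuousOnInterval

theorem lipschitzOn_comp {X Y : Type*} [PseudoMetricSpace X] [PseudoMetricSpace Y] {g : X → Y}
    {K : NNReal} {s : Set X} {f : ℝ → X} {a b : ℝ} (hg : LipschitzOnWith K g s)
    (hf : AbsolutelyContinuousOnInterval f a b) (hs : MapsTo f (uIcc a b) s) :
    AbsolutelyContinuousOnInterval (fun x => g (f x)) a b := by
  have h : Tendsto (fun E : ℕ × (ℕ → ℝ × ℝ) =>
      (K : ℝ) * ∑ i ∈ Finset.range E.1, dist (f (E.2 i).1) (f (E.2 i).2))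
      (totalLengthFilter ⊓ 𝓟 (disjWithin a b)) (𝓝 0) := by
    simpa using Tendsto.const_mul (K : ℝ) hf
  refine squeeze_zero' (Eventually.of_forall fun _ => Finset.sum_nonneg fun _ _ => dist_nonneg)
    ?_ h
  rw [eventually_inf_principal]
  refine Eventually.of_forall fun E hE => ?_
  rw [Finset.mul_sum]
  refine Finset.sum_le_sum fun i hi => ?_
  exact hg.dist_le_mul _ (hs (hE.1 i hi).1) _ (hs (hE.1 i hi).2)

theorem conj_complex {f : ℝ → ℂ} {a b : ℝ} (hf : AbsolutelyContinuousOnInterval f a b) :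
    AbsolutelyContinuousOnInterval (fun x => conj (f x)) a b :=
  lipschitzOn_comp (Complex.conjLIE.lipschitz.lipschitzOnWith (s := univ)) hf (mapsTo_univ _ _)

theorem mul_complex {f g : ℝ → ℂ} {a b : ℝ} (hf : AbsolutelyContinuousOnInterval f a b)
    (hg : AbsolutelyContinuousOnInterval g a b) :
    AbsolutelyContinuousOnInterval (fun x => f x * g x) a b :=
  hf.smul hg

theorem intervalIntegral_complex {g : ℝ → ℂ} {a b : ℝ} (hg : IntervalIntegrable g volume a b) :
    AbsolutelyContinuousOnInterval (fun x => ∫ t in a..x, g t) a b := by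
  have h1 : IntervalIntegrable (fun t => (g t).re) volume a b :=
    ⟨hg.1.re, hg.2.re⟩
  have h2 : IntervalIntegrable (fun t => (g t).im) volume a b :=
    ⟨hg.1.im, hg.2.im⟩
  have k1 := lipschitzOn_comp (Complex.ofRealLI.lipschitz.lipschitzOnWith (s := univ))
    (h1.absolutelyContinuousOnInterval_intervalIntegral (left_mem_uIcc)) (mapsTo_univ _ _)
  have k2 := lipschitzOn_comp (Complex.ofRealLI.lipschitz.lipschitzOnWith (s := univ))
    (h2.absolutelyContinuousOnInterval_intervalIntegral (left_mem_uIcc)) (mapsTo_univ _ _)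
  have k := k1.add (k2.const_smul Complex.I)
  refine Tendsto.congr' ?_ k
  rw [EventuallyEq, eventually_inf_principal]
  refine Eventually.of_forall fun E hE => Finset.sum_congr rfl fun i hi => ?_
  have key : ∀ x ∈ uIcc a b, ((∫ t in a..x, (g t).re : ℝ) : ℂ)
      + Complex.I • ((∫ t in a..x, (g t).im : ℝ) : ℂ) = ∫ t in a..x, g t := by
    intro x hx
    have hgx : IntervalIntegrable g volume a x := hg.mono_set (uIcc_subset_uIcc_left hx)
    rw [← intervalIntegral.integral_ofReal, ← intervalIntegral.integral_ofReal, smul_eq_mul,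
      ← intervalIntegral.integral_const_mul, ← intervalIntegral.integral_add]
    · refine intervalIntegral.integral_congr fun t _ => ?_
      rw [mul_comm, Complex.re_add_im]
    · exact IntervalIntegrable.mono_set (⟨h1.1.ofReal, h1.2.ofReal⟩ :
        IntervalIntegrable (fun t => ((g t).re : ℂ)) volume a b) (uIcc_subset_uIcc_left hx)
    · exact (IntervalIntegrable.mono_set (⟨h2.1.ofReal, h2.2.ofReal⟩ :
        IntervalIntegrable (fun t => ((g t).im : ℂ)) volume a b)
        (uIcc_subset_uIcc_left hx)).const_mul _
  simp only [Pi.add_apply]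
  rw [← key _ (hE.1 i hi).1, ← key _ (hE.1 i hi).2]
  rfl

/-- An absolutely continuous function whose derivative vanishes almost everywhere on `[0, ∞)` is
constant there. -/
theorem eq_of_ae_hasDerivAt_zero {f : ℝ → ℂ}
    (hf : ∀ R : ℝ, 0 ≤ R → AbsolutelyContinuousOnInterval f 0 R) {R : ℝ}
    (h : ∀ᵐ x ∂(volume.restrict (Icc (0 : ℝ) R)), HasDerivAt f 0 x) {x : ℝ} (hx : 0 ≤ x)
    (hxR : x ≤ R) : f x = f 0 := by
  have hR : 0 ≤ R := hx.trans hxR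
  obtain ⟨C, hC⟩ := (hf R hR).const_of_ae_hasDerivAt_zero (by
    rw [uIcc_of_le hR]
    exact (ae_restrict_iff' measurableSet_Icc).1 h)
  rw [uIcc_of_le hR] at hC
  rw [hC x ⟨hx, hxR⟩, hC 0 ⟨le_rfl, hR⟩]

end AbsolutelyContinuousOnInterval

/-! ### The scalar form of the Dirac system: determinant, uniqueness, symmetries, concatenation. -/

/-- `(a, b)` is a solution on `[0, ∞)` of `a' = conj b * w`, `b' = conj a * w` with
`a 0 = 1`, `b 0 = 0`. -/
structure IsDiracFlow (w a b : ℝ → ℂ) : Prop where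
  a_zero : a 0 = 1
  b_zero : b 0 = 0
  absCont_a : ∀ R : ℝ, 0 ≤ R → AbsolutelyContinuousOnInterval a 0 R
  absCont_b : ∀ R : ℝ, 0 ≤ R → AbsolutelyContinuousOnInterval b 0 R
  deriv : ∀ᵐ x ∂(volume.restrict (Ici (0 : ℝ))),
    HasDerivAt a (conj (b x) * w x) x ∧ HasDerivAt b (conj (a x) * w x) x

theorem HasDerivAt.conj_complex {f : ℝ → ℂ} {f' : ℂ} {x : ℝ} (h : HasDerivAt f f' x) :
    HasDerivAt (fun y => conj (f y)) (conj f') x := by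
  simpa using h.star

/-- The second column of the matrix equation is the conjugate of the first with its entries swapped,
so two scalar equations suffice. -/
theorem isDiracSolution_iff {d : ℕ} {f : ℝ → ℂ} {ξ : ℝ} {a b : ℝ → ℂ} :
    IsDiracSolution d f ξ a b ↔ IsDiracFlow (fun x => f x * cantorChar d x ξ) a b := by
  constructor
  · rintro ⟨h0, ha, hb, ho⟩
    refine ⟨?_, ?_, ha, hb, ?_⟩
    · simpa [su11Matrix] using congrFun (congrFun h0 0) 0
    · simpa [su11Matrix] using congrFun (congrFun h0 1) 0
    · filter_upwards [ho] with x hx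
      refine ⟨?_, ?_⟩
      · simpa [su11Matrix, diracCoeff, Matrix.mul_apply, Fin.sum_univ_two] using hx 0 0
      · simpa [su11Matrix, diracCoeff, Matrix.mul_apply, Fin.sum_univ_two] using hx 1 0
  · rintro ⟨h0, h1, ha, hb, ho⟩
    refine ⟨?_, ha, hb, ?_⟩
    · rw [h0, h1]
      ext i j
      fin_cases i <;> fin_cases j <;> simp [su11Matrix]
    · filter_upwards [ho] with x hx i j
      have k1 := hx.1.conj_complex
      have k2 := hx.2.conj_complex
      fin_cases i <;> fin_cases j
      · simpa [su11Matrix, diracCoeff, Matrix.mul_apply, Fin.sum_univ_two] using hx.1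
      · simpa [su11Matrix, diracCoeff, Matrix.mul_apply, Fin.sum_univ_two] using k2
      · simpa [su11Matrix, diracCoeff, Matrix.mul_apply, Fin.sum_univ_two] using hx.2
      · simpa [su11Matrix, diracCoeff, Matrix.mul_apply, Fin.sum_univ_two] using k1

namespace IsDiracFlow

variable {w w' a b a' b' : ℝ → ℂ}

/-- `G G'⁻¹` is the identity for two solutions `G` and `G'`. -/
theorem mul_inv_eq_one (h : IsDiracFlow w a b) (h' : IsDiracFlow w a' b') {x : ℝ} (hx : 0 ≤ x) :
    a x * conj (a' x) - conj (b x) * b' x = 1 ∧ b x * conj (a' x) - conj (a x) * b' x = 0 := by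
  have hI : ∀ᵐ y ∂(volume.restrict (Icc (0 : ℝ) x)),
      (HasDerivAt a (conj (b y) * w y) y ∧ HasDerivAt b (conj (a y) * w y) y) ∧
      (HasDerivAt a' (conj (b' y) * w y) y ∧ HasDerivAt b' (conj (a' y) * w y) y) := by
    refine ae_restrict_of_ae_restrict_of_subset Icc_subset_Ici_self ?_
    filter_upwards [h.deriv, h'.deriv] with y h1 h2 using ⟨h1, h2⟩
  constructor
  -- The adjugate of `G'` stands in for its inverse, since the determinant is not yet known. As `W`
  -- has trace zero, `(adj G')' = -W adj G'`, and the derivative of `G adj G'` cancels.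
  · have key := AbsolutelyContinuousOnInterval.eq_of_ae_hasDerivAt_zero
      (f := fun x => a x * conj (a' x) - conj (b x) * b' x)
      (fun R hR => ((h.absCont_a R hR).mul_complex (h'.absCont_a R hR).conj_complex).sub
        ((h.absCont_b R hR).conj_complex.mul_complex (h'.absCont_b R hR))) (R := x) ?_ hx le_rfl
    · simpa [h.a_zero, h.b_zero, h'.a_zero, h'.b_zero] using key
    · filter_upwards [hI] with y hy
      convert! (hy.1.1.mul hy.2.1.conj_complex).sub (hy.1.2.conj_complex.mul hy.2.2) using 1
      simp
      ring
  · have key := AbsolutelyContinuousOnInterval.eq_of_ae_hasDerivAt_zero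
      (f := fun x => b x * conj (a' x) - conj (a x) * b' x)
      (fun R hR => ((h.absCont_b R hR).mul_complex (h'.absCont_a R hR).conj_complex).sub
        ((h.absCont_a R hR).conj_complex.mul_complex (h'.absCont_b R hR))) (R := x) ?_ hx le_rfl
    · simpa [h.a_zero, h.b_zero, h'.a_zero, h'.b_zero] using key
    · filter_upwards [hI] with y hy
      convert! (hy.1.2.mul hy.2.1.conj_complex).sub (hy.1.1.conj_complex.mul hy.2.2) using 1
      simp
      ring

theorem det_eq_one (h : IsDiracFlow w a b) {x : ℝ} (hx : 0 ≤ x) :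
    ‖a x‖ ^ 2 - ‖b x‖ ^ 2 = 1 := by
  have := (h.mul_inv_eq_one h hx).1
  rw [Complex.mul_conj', Complex.conj_mul'] at this
  exact_mod_cast this

/-- No Gronwall argument is needed: `G adj G' = 1` together with `det G' = 1` gives `G = G'` by
linear algebra. -/
theorem unique (h : IsDiracFlow w a b) (h' : IsDiracFlow w a' b') {x : ℝ} (hx : 0 ≤ x) :
    a x = a' x ∧ b x = b' x := by
  obtain ⟨h1, h2⟩ := h.mul_inv_eq_one h' hx
  have h3 := (h.mul_inv_eq_one h hx).1
  have h4 := (h'.mul_inv_eq_one h' hx).1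
  have h2' : conj (b x) * a' x - a x * conj (b' x) = 0 := by
    have := congrArg conj h2
    simpa using this
  constructor
  · linear_combination (-a x) * h4 + a' x * h1 + b' x * h2'
  · have h1' : conj (a x) * a' x - b x * conj (b' x) = 1 := by
      have := congrArg conj h1
      simpa using this
    linear_combination (-b x) * h4 + b' x * h1' + a' x * h2

/-- Multiplying the potential by a unimodular constant rotates `b`. -/
theorem const_mul (h : IsDiracFlow w a b) {u : ℂ} (hu : ‖u‖ = 1) :
    IsDiracFlow (fun x => u * w x) a (fun x => u * b x) := by
  have huu : conj u * u = 1 := by rw [Complex.conj_mul', hu]; simp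
  refine ⟨h.a_zero, by simp [h.b_zero], h.absCont_a, fun R hR => (h.absCont_b R hR).const_smul u,
    ?_⟩
  filter_upwards [h.deriv] with x hx
  refine ⟨?_, ?_⟩
  · convert! hx.1 using 1
    simp only [map_mul]
    linear_combination conj (b x) * w x * huu
  · convert! hx.2.const_mul u using 1
    ring

theorem congr_ae (h : IsDiracFlow w a b) (hw : ∀ᵐ x ∂(volume.restrict (Ici (0 : ℝ))), w x = w' x) :
    IsDiracFlow w' a b := by
  refine ⟨h.a_zero, h.b_zero, h.absCont_a, h.absCont_b, ?_⟩
  filter_upwards [h.deriv, hw] with x hx e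
  rwa [← e]

/-- A solution is constant on an interval on which the potential vanishes. -/
theorem eq_of_eq_zero_on (h : IsDiracFlow w a b) {r s : ℝ} (hr : 0 ≤ r) (hrs : r ≤ s)
    (hw : ∀ x, r ≤ x → x < s → w x = 0) : a s = a r ∧ b s = b r := by
  have key : ∀ f : ℝ → ℂ, (∀ R : ℝ, 0 ≤ R → AbsolutelyContinuousOnInterval f 0 R) →
      (∀ᵐ x ∂(volume.restrict (Ici (0 : ℝ))), w x = 0 → HasDerivAt f 0 x) → f s = f r := by
    intro f hf hd
    obtain ⟨C, hC⟩ := ((hf s (hr.trans hrs)).mono (c := r) (d := s) (by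
      rw [uIcc_of_le hrs, uIcc_of_le (hr.trans hrs)]
      exact Icc_subset_Icc_left hr)).const_of_ae_hasDerivAt_zero (by
        rw [uIcc_of_le hrs]
        -- The potential may be nonzero at the right endpoint `s`, which is discarded as a null set.
        filter_upwards [(ae_restrict_iff' measurableSet_Ici).1 hd,
          (Set.countable_singleton s).ae_notMem volume] with x h1 h2 h3
        exact h1 (hr.trans h3.1) (hw x h3.1 (lt_of_le_of_ne h3.2 h2)))
    rw [hC s right_mem_uIcc, hC r left_mem_uIcc]
  refine ⟨key a h.absCont_a ?_, key b h.absCont_b ?_⟩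
  · filter_upwards [h.deriv] with x hx e
    simpa [e] using hx.1
  · filter_upwards [h.deriv] with x hx e
    simpa [e] using hx.2

/-- Solutions for potentials supported on consecutive intervals multiply. -/
theorem mul {s : ℝ} (h : IsDiracFlow w a b) (h' : IsDiracFlow w' a' b')
    (hw : ∀ x, s ≤ x → w x = 0) (hw' : ∀ x, x < s → w' x = 0) :
    IsDiracFlow (fun x => w x + w' x) (fun x => a x * a' x + conj (b x) * b' x)
      (fun x => b x * a' x + conj (a x) * b' x) := by
  refine ⟨by simp [h.a_zero, h.b_zero, h'.a_zero], by simp [h.b_zero, h'.b_zero], fun R hR => ?_,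
    fun R hR => ?_, ?_⟩
  · exact ((h.absCont_a R hR).mul_complex (h'.absCont_a R hR)).add
      ((h.absCont_b R hR).conj_complex.mul_complex (h'.absCont_b R hR))
  · exact ((h.absCont_b R hR).mul_complex (h'.absCont_a R hR)).add
      ((h.absCont_a R hR).conj_complex.mul_complex (h'.absCont_b R hR))
  · filter_upwards [h.deriv, h'.deriv, ae_restrict_mem measurableSet_Ici] with x h1 h2 hx
    have hd1 := (h1.1.mul h2.1).add (h1.2.conj_complex.mul h2.2)
    have hd2 := (h1.2.mul h2.1).add (h1.1.conj_complex.mul h2.2)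
    -- Left of `s` the second solution is still the identity; right of `s` the first potential is
    -- zero. In both cases the product rule leaves the required derivative.
    rcases lt_or_ge x s with hxs | hxs
    · obtain ⟨e1, e2⟩ := h'.eq_of_eq_zero_on le_rfl hx (fun y _ hy => hw' y (hy.trans hxs))
      rw [h'.a_zero] at e1
      rw [h'.b_zero] at e2
      refine ⟨?_, ?_⟩
      · convert! hd1 using 1
        simp [e1, e2, hw' x hxs]
      · convert! hd2 using 1
        simp [e1, e2, hw' x hxs]
    · refine ⟨?_, ?_⟩
      · convert! hd1 using 1
        simp [hw x hxs]
        ring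
      · convert! hd2 using 1
        simp [hw x hxs]
        ring

end IsDiracFlow

/-! ### Hausdorff–Young on `ℤ / dℤ` for Hilbert-space-valued sequences. -/

section HausdorffYoung

variable {E : Type*} [NormedAddCommGroup E] [InnerProductSpace ℂ E]

theorem sum_pow_mul_conj_pow {d : ℕ} {ω : ℂ} (hω : IsPrimitiveRoot ω d) {l m : ℕ} (hl : l < d)
    (hm : m < d) :
    ∑ j ∈ Finset.range d, conj (ω ^ (j * l)) * ω ^ (j * m) = if l = m then (d : ℂ) else 0 := by
  have hd : d ≠ 0 := by omega
  have hn : ‖ω‖ = 1 := hω.norm'_eq_one hd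
  have hω0 : ω ≠ 0 := hω.ne_zero hd
  have hc : ∀ k, conj (ω ^ k) = (ω ^ k)⁻¹ := fun k => by
    rw [Complex.inv_def, Complex.normSq_eq_norm_sq, norm_pow, hn]; simp
  split_ifs with h
  · subst h
    simp [hc, hω0]
  · have hne : ω ^ m * (ω ^ l)⁻¹ ≠ 1 := by
      intro h1
      rw [mul_inv_eq_one₀ (pow_ne_zero _ hω0)] at h1
      exact h (hω.pow_inj hm hl h1).symm
    have : ∀ j ∈ Finset.range d, conj (ω ^ (j * l)) * ω ^ (j * m) = (ω ^ m * (ω ^ l)⁻¹) ^ j := by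
      intro j _
      rw [hc, mul_comm j l, mul_comm j m, pow_mul, pow_mul, mul_pow, inv_pow, mul_comm]
    rw [Finset.sum_congr rfl this, geom_sum_eq hne, mul_pow, inv_pow, ← pow_mul, ← pow_mul,
      mul_comm m, mul_comm l, pow_mul, pow_mul, hω.pow_eq_one]
    simp

/-- Parseval's identity on `ℤ / dℤ`. -/
theorem sum_norm_sq_sum_pow_smul {d : ℕ} {ω : ℂ} (hω : IsPrimitiveRoot ω d) (v : ℕ → E) :
    ∑ j ∈ Finset.range d, ‖∑ l ∈ Finset.range d, ω ^ (j * l) • v l‖ ^ 2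
      = d * ∑ l ∈ Finset.range d, ‖v l‖ ^ 2 := by
  have h : (∑ j ∈ Finset.range d, (‖∑ l ∈ Finset.range d, ω ^ (j * l) • v l‖ : ℂ) ^ 2)
      = d * ∑ l ∈ Finset.range d, (‖v l‖ : ℂ) ^ 2 := by
    have h1 : ∀ x : E, (‖x‖ : ℂ) ^ 2 = inner ℂ x x := fun x => by
      rw [inner_self_eq_norm_sq_to_K]; simp
    simp_rw [h1, sum_inner, inner_sum, inner_smul_left, inner_smul_right]
    rw [Finset.sum_comm, Finset.mul_sum]
    refine Finset.sum_congr rfl fun l hl => ?_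
    rw [Finset.sum_comm]
    have : ∀ m ∈ Finset.range d, ∑ j ∈ Finset.range d, conj (ω ^ (j * l)) *
        (ω ^ (j * m) * inner ℂ (v l) (v m)) = if l = m then d * inner ℂ (v l) (v m) else 0 := by
      intro m hm
      simp_rw [← mul_assoc]
      rw [← Finset.sum_mul, sum_pow_mul_conj_pow hω (Finset.mem_range.1 hl) (Finset.mem_range.1 hm)]
      split_ifs <;> simp
    rw [Finset.sum_congr rfl this, Finset.sum_ite_eq]
    simp [hl]
  exact_mod_cast h

/-- Supplies the analytic family for interpolation: the scalar is entire in `s`, even for `v = 0`.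
The condition on `s.re` avoids `0 ^ 0 = 1`. -/
theorem norm_exp_mul_log_smul {F : Type*} [NormedAddCommGroup F] [NormedSpace ℂ F] (v : F) {s : ℂ}
    (hs : s.re ≠ 0) : ‖Complex.exp ((s - 1) * Real.log ‖v‖) • v‖ = ‖v‖ ^ s.re := by
  rcases eq_or_ne v 0 with rfl | hv
  · simp [hs]
  · have hv' : 0 < ‖v‖ := norm_pos_iff.2 hv
    rw [norm_smul, Complex.norm_exp, Complex.re_mul_ofReal, Complex.sub_re, Complex.one_re,
      Real.rpow_def_of_pos hv']
    nth_rewrite 2 [← Real.exp_log hv']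
    rw [← Real.exp_add]
    congr 1
    ring

open Complex.HadamardThreeLines in
/-- The Hausdorff–Young inequality on `ℤ / dℤ`, with constant one. -/
theorem sum_norm_rpow_sum_pow_smul_le {d : ℕ} {ω : ℂ} (hω : IsPrimitiveRoot ω d) {p q : ℝ}
    (hpq : p.HolderConjugate q) (hp : p ≤ 2) (v : ℕ → E) :
    ∑ j ∈ Finset.range d, ‖∑ l ∈ Finset.range d, ω ^ (j * l) • v l‖ ^ q
      ≤ d * (∑ l ∈ Finset.range d, ‖v l‖ ^ p) ^ (q / p) := by
  rcases Nat.eq_zero_or_pos d with rfl | hd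
  · simp
  have hn : ‖ω‖ = 1 := hω.norm'_eq_one hd.ne'
  set V : ℕ → E := fun j => ∑ l ∈ Finset.range d, ω ^ (j * l) • v l with hV
  set N : ℝ := ∑ j ∈ Finset.range d, ‖V j‖ ^ q with hN
  set S : ℝ := ∑ l ∈ Finset.range d, ‖v l‖ ^ p with hS
  have hp0 : 0 < p := hpq.pos
  have hq0 : 0 < q := hpq.symm.pos
  have hp1 : 1 < p := hpq.lt
  have hN0 : 0 ≤ N := Finset.sum_nonneg fun _ _ => by positivity
  have hS0 : 0 ≤ S := Finset.sum_nonneg fun _ _ => by positivity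
  -- `α` has real part `1` and `1/2` on the two edges of the strip and equals `1/p` at `z = 2/q`.
  -- The vectors `A z l • v l` and `B z j • V j` have norms `‖v l‖ ^ (p Re α)` and `‖V j‖ ^ (q Re
  -- α)`. The test vectors come from the transform `V` itself, so no duality argument is needed.
  let α : ℂ → ℂ := fun z => 1 - z / 2
  let A : ℂ → ℕ → ℂ := fun z l => Complex.exp ((p * α z - 1) * Real.log ‖v l‖)
  let B : ℂ → ℕ → ℂ := fun z j => Complex.exp ((q * α z - 1) * Real.log ‖V j‖)
  let H : ℂ → ℂ := fun z => ∑ j ∈ Finset.range d, ∑ l ∈ Finset.range d,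
    B z j * (A z l * (ω ^ (j * l) * inner ℂ (V j) (v l)))
  have hA : ∀ z l, (α z).re ≠ 0 → ‖A z l‖ * ‖v l‖ = ‖v l‖ ^ (p * (α z).re) := by
    intro z l hz
    rw [← norm_smul]
    have := norm_exp_mul_log_smul (v l) (s := p * α z) (by simp [hp0.ne', hz])
    rwa [Complex.re_ofReal_mul] at this
  have hB : ∀ z l, (α z).re ≠ 0 → ‖B z l‖ * ‖V l‖ = ‖V l‖ ^ (q * (α z).re) := by
    intro z l hz
    rw [← norm_smul]
    have := norm_exp_mul_log_smul (V l) (s := q * α z) (by simp [hq0.ne', hz])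
    rwa [Complex.re_ofReal_mul] at this
  have hterm : ∀ z j l, ‖B z j * (A z l * (ω ^ (j * l) * inner ℂ (V j) (v l)))‖
      ≤ (‖B z j‖ * ‖V j‖) * (‖A z l‖ * ‖v l‖) := by
    intro z j l
    rw [norm_mul, norm_mul, norm_mul, norm_pow, hn, one_pow, one_mul]
    calc ‖B z j‖ * (‖A z l‖ * ‖inner ℂ (V j) (v l)‖)
        ≤ ‖B z j‖ * (‖A z l‖ * (‖V j‖ * ‖v l‖)) := by gcongr; exact norm_inner_le_norm _ _
      _ = _ := by ring
  have hdiff : Differentiable ℂ H := by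
    simp only [H, A, B, α]
    fun_prop
  have hre : ∀ z : ℂ, (α z).re = 1 - z.re / 2 := by
    intro z
    simp [α]
  have hαpos : ∀ z ∈ verticalClosedStrip 0 1, (α z).re ≠ 0 ∧ 0 ≤ (α z).re ∧ (α z).re ≤ 1 := by
    intro z hz
    have h1 : 0 ≤ z.re := hz.1
    have h2 : z.re ≤ 1 := hz.2
    rw [hre]
    refine ⟨?_, ?_, ?_⟩
    · intro h; linarith
    · linarith
    · linarith
  have hbdd : BddAbove ((norm ∘ H) '' verticalClosedStrip 0 1) := by
    refine ⟨∑ j ∈ Finset.range d, ∑ l ∈ Finset.range d, (1 + ‖V j‖) ^ q * (1 + ‖v l‖) ^ p, ?_⟩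
    rintro _ ⟨z, hz, rfl⟩
    obtain ⟨h0, h1, h2⟩ := hαpos z hz
    refine (norm_sum_le _ _).trans (Finset.sum_le_sum fun j _ => (norm_sum_le _ _).trans
      (Finset.sum_le_sum fun l _ => (hterm z j l).trans ?_))
    rw [hA z l h0, hB z j h0]
    have aux : ∀ (t r : ℝ), 0 ≤ t → 0 ≤ r → t ^ (r * (α z).re) ≤ (1 + t) ^ r := by
      intro t r ht hr
      calc t ^ (r * (α z).re) ≤ (1 + t) ^ (r * (α z).re) :=
            Real.rpow_le_rpow ht (by linarith) (by positivity)
        _ ≤ (1 + t) ^ r := Real.rpow_le_rpow_of_exponent_le (by linarith)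
            (mul_le_of_le_one_right hr h2)
    exact mul_le_mul (aux _ _ (norm_nonneg _) hq0.le) (aux _ _ (norm_nonneg _) hp0.le)
      (by positivity) (by positivity)
  have hleft : ∀ z ∈ Complex.re ⁻¹' {(0 : ℝ)}, ‖H z‖ ≤ N * S := by
    intro z hz
    have hz0 : z.re = 0 := hz
    have h1 : (α z).re = 1 := by rw [hre, hz0]; norm_num
    have h0 : (α z).re ≠ 0 := by rw [h1]; norm_num
    rw [hN, hS, Finset.sum_mul_sum]
    refine (norm_sum_le _ _).trans (Finset.sum_le_sum fun j _ => (norm_sum_le _ _).trans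
      (Finset.sum_le_sum fun l _ => (hterm z j l).trans ?_))
    rw [hA z l h0, hB z j h0, h1, mul_one, mul_one]
  -- On this edge Cauchy–Schwarz and Parseval apply; the left edge used only `|ω| = 1`.
  have hright : ∀ z ∈ Complex.re ⁻¹' {(1 : ℝ)}, ‖H z‖ ≤ Real.sqrt N * Real.sqrt (d * S) := by
    intro z hz
    have hz0 : z.re = 1 := hz
    have h1 : (α z).re = 1 / 2 := by rw [hre, hz0]; norm_num
    have h0 : (α z).re ≠ 0 := by rw [h1]; norm_num
    have hsq : ∀ (t r : ℝ), 0 ≤ t → (t ^ (r * (α z).re)) ^ 2 = t ^ r := by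
      intro t r ht
      rw [h1, ← Real.rpow_natCast, ← Real.rpow_mul ht]
      congr 1
      push_cast
      ring
    have e : H z = ∑ j ∈ Finset.range d, B z j *
        inner ℂ (V j) (∑ l ∈ Finset.range d, ω ^ (j * l) • (A z l • v l)) := by
      refine Finset.sum_congr rfl fun j _ => ?_
      rw [inner_sum, Finset.mul_sum]
      refine Finset.sum_congr rfl fun l _ => ?_
      rw [inner_smul_right, inner_smul_right]
      ring
    rw [e]
    refine (norm_sum_le _ _).trans ?_
    calc _ ≤ ∑ j ∈ Finset.range d, (‖B z j‖ * ‖V j‖) *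
          ‖∑ l ∈ Finset.range d, ω ^ (j * l) • (A z l • v l)‖ := by
          refine Finset.sum_le_sum fun j _ => ?_
          rw [norm_mul, mul_assoc]
          gcongr
          exact norm_inner_le_norm _ _
      _ ≤ Real.sqrt (∑ j ∈ Finset.range d, (‖B z j‖ * ‖V j‖) ^ 2) * Real.sqrt
          (∑ j ∈ Finset.range d, ‖∑ l ∈ Finset.range d, ω ^ (j * l) • (A z l • v l)‖ ^ 2) :=
          Real.sum_mul_le_sqrt_mul_sqrt _ _ _
      _ = _ := by
          rw [sum_norm_sq_sum_pow_smul hω]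
          congr 2
          · refine Finset.sum_congr rfl fun j _ => ?_
            rw [hB z j h0, hsq _ _ (norm_nonneg _)]
          · congr 1
            refine Finset.sum_congr rfl fun j _ => ?_
            rw [norm_smul, hA z j h0, hsq _ _ (norm_nonneg _)]
  have hinv : p⁻¹ + q⁻¹ = 1 := hpq.inv_add_inv_eq_one
  let θ : ℝ := 2 * q⁻¹
  have hp2 : 2⁻¹ ≤ p⁻¹ := by gcongr
  have hθ0 : 0 ≤ θ := by positivity
  have hθ1 : θ ≤ 1 := by simp only [θ]; linarith
  have hαθ : α θ = (p⁻¹ : ℝ) := by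
    simp only [α, θ]
    rw [eq_sub_of_add_eq hinv]
    push_cast
    ring
  have main := norm_le_interp_of_mem_verticalClosedStrip₀₁' H (z := (θ : ℂ)) (a := N * S)
    (b := Real.sqrt N * Real.sqrt (d * S)) ⟨by simpa using hθ0, by simpa using hθ1⟩
    hdiff.diffContOnCl hbdd hleft hright
  -- At `θ = 2/q` one has `A = 1` and, where `V j ≠ 0`, `B = ‖V j‖ ^ (q - 2)`, so `H θ` is the sum
  -- to be bounded. `N` then stands on both sides of the interpolation bound, and `N ^ (1/p)` is
  -- divided out once `N = 0` is set aside.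
  have hHθ : H θ = (N : ℂ) := by
    have e : ∀ j ∈ Finset.range d, ∑ l ∈ Finset.range d,
        B θ j * (A θ l * (ω ^ (j * l) * inner ℂ (V j) (v l))) = ((‖V j‖ ^ q : ℝ) : ℂ) := by
      intro j _
      have hA1 : ∀ l, A θ l = 1 := by
        intro l
        simp only [A]
        rw [hαθ, ← Complex.ofReal_mul, mul_inv_cancel₀ hp0.ne']
        simp
      simp_rw [hA1, one_mul]
      rw [← Finset.mul_sum]
      simp_rw [← inner_smul_right]
      rw [← inner_sum]
      change B θ j * inner ℂ (V j) (V j) = _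
      rw [inner_self_eq_norm_sq_to_K]
      rcases eq_or_ne (V j) 0 with h0 | h0
      · simp [h0, hq0.ne']
      · have hpos : 0 < ‖V j‖ := norm_pos_iff.2 h0
        simp only [B]
        rw [hαθ, Real.rpow_def_of_pos hpos]
        have hqp : q * p⁻¹ - 1 = q - 2 := by
          rw [eq_sub_of_add_eq hinv]; field_simp; ring
        rw [← Complex.ofReal_mul, ← Complex.ofReal_one, ← Complex.ofReal_sub, hqp,
          ← Complex.ofReal_mul, ← Complex.ofReal_exp]
        have : Real.exp (Real.log ‖V j‖ * q)
            = Real.exp ((q - 2) * Real.log ‖V j‖) * ‖V j‖ ^ 2 := by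
          nth_rewrite 3 [← Real.exp_log hpos]
          rw [← Real.exp_nat_mul, ← Real.exp_add]
          congr 1
          push_cast
          ring
        rw [this]
        push_cast
        rfl
    simp only [H]
    rw [Finset.sum_congr rfl e, hN]
    push_cast
    rfl
  rw [hHθ, Complex.norm_of_nonneg hN0, Complex.ofReal_re] at main
  rcases hN0.eq_or_lt with h0 | hNpos
  · rw [← h0]; positivity
  have hd0 : (0 : ℝ) ≤ d := by positivity
  have e1 : (N * S) ^ (1 - θ) * (Real.sqrt N * Real.sqrt (d * S)) ^ θ
      = N ^ p⁻¹ * S ^ p⁻¹ * (d : ℝ) ^ q⁻¹ := by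
    rw [← Real.sqrt_mul hN0, Real.sqrt_eq_rpow, ← Real.rpow_mul (by positivity)]
    have : 1 / 2 * θ = q⁻¹ := by simp only [θ]; ring
    rw [this, show N * (d * S) = (N * S) * d by ring, Real.mul_rpow (by positivity) hd0,
      ← mul_assoc, ← Real.mul_rpow hN0 hS0]
    congr 1
    have hpe : p⁻¹ = (1 - θ) + q⁻¹ := by simp only [θ]; linarith
    rw [hpe, Real.rpow_add_of_nonneg (by positivity) (by linarith) (by positivity)]
  rw [e1] at main
  have e2 : N ^ q⁻¹ ≤ S ^ p⁻¹ * (d : ℝ) ^ q⁻¹ := by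
    have hNp : 0 < N ^ p⁻¹ := by positivity
    have : N = N ^ p⁻¹ * N ^ q⁻¹ := by rw [← Real.rpow_add hNpos, hinv, Real.rpow_one]
    rw [mul_assoc] at main
    nth_rewrite 1 [this] at main
    exact le_of_mul_le_mul_left main hNp
  have e3 := Real.rpow_le_rpow (by positivity) e2 hq0.le
  rwa [← Real.rpow_mul hN0, inv_mul_cancel₀ hq0.ne', Real.rpow_one, Real.mul_rpow (by positivity)
    (by positivity), ← Real.rpow_mul hS0, ← Real.rpow_mul hd0, inv_mul_cancel₀ hq0.ne',
    Real.rpow_one, mul_comm, inv_mul_eq_div] at e3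

/-- A scalar form of the Hausdorff–Young inequality in which the off-diagonal terms may be damped:
`|γ l| ≤ x l` instead of equality. -/
theorem sum_rpow_le_of_sq_le {d : ℕ} {ω : ℂ} (hω : IsPrimitiveRoot ω d) {p q : ℝ}
    (hpq : p.HolderConjugate q) (hp : p ≤ 2) {x y : ℕ → ℝ} {γ : ℕ → ℂ} (hy : ∀ j, 0 ≤ y j)
    (hx : ∀ l < d, 0 ≤ x l) (hγ : ∀ l < d, ‖γ l‖ ^ 2 ≤ x l ^ 2)
    (h : ∀ j < d, y j ^ 2 ≤ ∑ l ∈ Finset.range d, x l ^ 2 +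
      ‖∑ l ∈ Finset.range d, ω ^ (j * l) * γ l‖ ^ 2 - ∑ l ∈ Finset.range d, ‖γ l‖ ^ 2) :
    ∑ j ∈ Finset.range d, y j ^ q ≤ d * (∑ l ∈ Finset.range d, x l ^ p) ^ (q / p) := by
  -- Each `γ l` is completed by an orthogonal coordinate of its own to a vector of norm `x l`. These
  -- extra coordinates do not interfere, so they add `x l ^ 2 - ‖γ l‖ ^ 2` to the squared norm of
  -- every transform.
  let v : ℕ → EuclideanSpace ℂ (Option (Fin d)) := fun l => WithLp.toLp 2 fun i =>
    i.elim (γ l) fun i => if (i : ℕ) = l then ((Real.sqrt (x l ^ 2 - ‖γ l‖ ^ 2) : ℝ) : ℂ) else 0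
  have hs : ∀ l < d, Real.sqrt (x l ^ 2 - ‖γ l‖ ^ 2) ^ 2 = x l ^ 2 - ‖γ l‖ ^ 2 :=
    fun l hl => Real.sq_sqrt (sub_nonneg.2 (hγ l hl))
  have hv : ∀ l < d, ‖v l‖ = x l := by
    intro l hl
    rw [← sq_eq_sq₀ (norm_nonneg _) (hx l hl), EuclideanSpace.norm_sq_eq, Fintype.sum_option,
      Finset.sum_eq_single ⟨l, hl⟩]
    · simp [v, hs l hl]
    · intro i _ hi
      have : (i : ℕ) ≠ l := fun h => hi (Fin.ext h)
      simp [v, this]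
    · simp
  have hV : ∀ j < d, ‖∑ l ∈ Finset.range d, ω ^ (j * l) • v l‖ ^ 2 =
      ∑ l ∈ Finset.range d, x l ^ 2 +
      ‖∑ l ∈ Finset.range d, ω ^ (j * l) * γ l‖ ^ 2 - ∑ l ∈ Finset.range d, ‖γ l‖ ^ 2 := by
    intro j hj
    have hn : ‖ω‖ = 1 := hω.norm'_eq_one (by omega)
    have h2 : ∀ i : Fin d, (∑ l ∈ Finset.range d, ω ^ (j * l) • v l) (some i)
        = ω ^ (j * i) * (Real.sqrt (x i ^ 2 - ‖γ i‖ ^ 2) : ℝ) := by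
      intro i
      rw [WithLp.ofLp_sum, Finset.sum_apply, Finset.sum_eq_single (i : ℕ)]
      · simp [v]
      · intro l _ hli
        simp [v, hli.symm]
      · intro hi
        exact absurd (Finset.mem_range.2 i.2) hi
    rw [EuclideanSpace.norm_sq_eq, Fintype.sum_option]
    simp_rw [h2, norm_mul, norm_pow, hn, one_pow, one_mul, Complex.norm_real, Real.norm_eq_abs,
      sq_abs]
    rw [Fin.sum_univ_eq_sum_range (fun i => Real.sqrt (x i ^ 2 - ‖γ i‖ ^ 2) ^ 2) d,
      Finset.sum_congr rfl fun l hl => hs l (Finset.mem_range.1 hl), Finset.sum_sub_distrib]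
    rw [WithLp.ofLp_sum, Finset.sum_apply]
    simp only [v, PiLp.smul_apply, Option.elim_none, smul_eq_mul]
    ring
  refine le_trans (Finset.sum_le_sum fun j hj => ?_) ((sum_norm_rpow_sum_pow_smul_le hω hpq hp
    v).trans (le_of_eq ?_))
  · have hj' := Finset.mem_range.1 hj
    refine Real.rpow_le_rpow (hy j) ?_ hpq.symm.pos.le
    exact le_of_sq_le_sq ((h j hj').trans_eq (hV j hj').symm) (norm_nonneg _)
  · congr 2
    exact Finset.sum_congr rfl fun l hl => by rw [hv l (Finset.mem_range.1 hl)]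

end HausdorffYoung

/-! ### Products in SU(1,1) and the node inequality. -/

/-- The first column of the product of the matrices `su11Matrix (α l) (β l)`, `l < n`. -/
def su11Prod (α β : ℕ → ℂ) : ℕ → ℂ × ℂ
  | 0 => (1, 0)
  | n + 1 => ((su11Prod α β n).1 * α n + conj (su11Prod α β n).2 * β n,
      (su11Prod α β n).2 * α n + conj (su11Prod α β n).1 * β n)

/-- The second elementary symmetric polynomial of `T l`, `l < n`. -/
def pairSum (T : ℕ → ℝ) (n : ℕ) : ℝ :=
  ∑ l ∈ Finset.range n, (∑ k ∈ Finset.range l, T k) * T l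

theorem pairSum_succ (T : ℕ → ℝ) (n : ℕ) :
    pairSum T (n + 1) = pairSum T n + (∑ k ∈ Finset.range n, T k) * T n :=
  Finset.sum_range_succ _ _

theorem pairSum_nonneg {T : ℕ → ℝ} (hT : ∀ l, 0 ≤ T l) (n : ℕ) : 0 ≤ pairSum T n :=
  Finset.sum_nonneg fun l _ => mul_nonneg (Finset.sum_nonneg fun k _ => hT k) (hT l)

theorem pairSum_le_sq {T : ℕ → ℝ} (hT : ∀ l, 0 ≤ T l) (n : ℕ) :
    pairSum T n ≤ (∑ k ∈ Finset.range n, T k) ^ 2 := by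
  induction n with
  | zero => simp [pairSum]
  | succ n ih =>
    rw [pairSum_succ, Finset.sum_range_succ]
    have h1 : 0 ≤ ∑ k ∈ Finset.range n, T k := Finset.sum_nonneg fun k _ => hT k
    nlinarith [mul_nonneg h1 (hT n), sq_nonneg (T n)]

/-- A Bonferroni inequality: truncating the alternating expansion after the second-order term
overestimates. -/
theorem prod_one_sub_le {T : ℕ → ℝ} (hT : ∀ l, 0 ≤ T l) (hT1 : ∀ l, T l ≤ 1) (n : ℕ) :
    ∏ l ∈ Finset.range n, (1 - T l) ≤ 1 - ∑ k ∈ Finset.range n, T k + pairSum T n := by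
  induction n with
  | zero => simp [pairSum]
  | succ n ih =>
    rw [pairSum_succ, Finset.sum_range_succ, Finset.prod_range_succ]
    have h1 := mul_le_mul_of_nonneg_right ih (sub_nonneg.2 (hT1 n))
    nlinarith [mul_nonneg (pairSum_nonneg hT n) (hT n)]

theorem le_prod_one_add_mul {T : ℕ → ℝ} (hT : ∀ l, 0 ≤ T l) {κ : ℝ} (hκ : 0 ≤ κ) (n : ℕ) :
    1 + κ * ∑ k ∈ Finset.range n, T k + κ ^ 2 * pairSum T n
      ≤ ∏ l ∈ Finset.range n, (1 + κ * T l) := by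
  induction n with
  | zero => simp [pairSum]
  | succ n ih =>
    rw [pairSum_succ, Finset.sum_range_succ, Finset.prod_range_succ]
    have h1 := mul_le_mul_of_nonneg_right ih (by have := hT n; positivity : 0 ≤ 1 + κ * T n)
    have h2 : 0 ≤ κ ^ 3 * pairSum T n * T n :=
      mul_nonneg (mul_nonneg (by positivity) (pairSum_nonneg hT n)) (hT n)
    nlinarith

/-- Estimates for the terms of the expansion of a product of `n` matrices in `SU(1,1)`. -/
theorem exists_expansion_bound (n : ℕ) : ∃ K : ℝ, 1 ≤ K ∧ ∀ τ t r L b : ℕ → ℝ,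
    (∀ l, 0 ≤ τ l) → (∀ l, τ l ≤ 1) → (∀ l, 0 ≤ t l) → (∀ l, 0 ≤ r l) → (∀ l, 0 ≤ L l) →
    (∀ l, 0 ≤ b l) → t 0 = 0 → r 0 = 0 → L 0 = 0 → (∀ l, t (l + 1) ≤ t l + b l * τ l) →
    (∀ l, r (l + 1) ≤ r l + t l * τ l) → (∀ l, L (l + 1) ≤ L l + τ l) →
    (∀ l, b l ≤ L l + r l) →
    L n ^ 2 ≤ K * ∑ l ∈ Finset.range n, τ l ^ 2 ∧
    t n ^ 2 ≤ K * pairSum (fun l => τ l ^ 2) n ∧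
    r n ^ 2 ≤ K * (pairSum (fun l => τ l ^ 2) n * ∑ l ∈ Finset.range n, τ l ^ 2) ∧
    L n * r n ≤ K * pairSum (fun l => τ l ^ 2) n := by
  induction n with
  | zero =>
    refine ⟨1, le_rfl, fun τ t r L b _ _ _ _ _ _ h1 h2 h3 _ _ _ _ => ?_⟩
    simp [h1, h2, h3, pairSum]
  | succ n ih =>
    obtain ⟨K, hK, ih⟩ := ih
    -- The factor comes from `(x + y)² ≤ 2x² + 2y²`, used for `b ≤ L + r` and again for `t`, and
    -- from `E ≤ Λ² ≤ n²`. The bound on `L r` is carried separately in the induction: multiplying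
    -- the bounds for `L` and `r` would give only `√E Λ`, which need not be `O(E)`.
    refine ⟨4 * K * (1 + n ^ 2), by nlinarith [sq_nonneg (n : ℝ)],
      fun τ t r L b hτ hτ1 ht hr hL hb h1 h2 h3 ht' hr' hL' hb' => ?_⟩
    obtain ⟨i1, i2, i3, i4⟩ := ih τ t r L b hτ hτ1 ht hr hL hb h1 h2 h3 ht' hr' hL' hb'
    have hE0 := pairSum_nonneg (T := fun l => τ l ^ 2) (fun l => sq_nonneg _) n
    have hEle := pairSum_le_sq (T := fun l => τ l ^ 2) (fun l => sq_nonneg _) n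
    have hΛ0 : 0 ≤ ∑ l ∈ Finset.range n, τ l ^ 2 := Finset.sum_nonneg fun k _ => sq_nonneg _
    have hΛn : ∑ l ∈ Finset.range n, τ l ^ 2 ≤ n := by
      refine (Finset.sum_le_card_nsmul _ _ 1 fun l _ => ?_).trans_eq (by simp)
      exact pow_le_one₀ (hτ l) (hτ1 l)
    rw [pairSum_succ, Finset.sum_range_succ]
    set E := pairSum (fun l => τ l ^ 2) n
    set Λ := ∑ l ∈ Finset.range n, τ l ^ 2
    have hT0 : 0 ≤ τ n ^ 2 := sq_nonneg _
    set T := τ n ^ 2 with hT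
    have hK0 : 0 ≤ K := by linarith
    set E' := E + Λ * T with hE'
    have hΛT : 0 ≤ Λ * T := mul_nonneg hΛ0 hT0
    have hE'0 : 0 ≤ E' := by positivity
    have hM : (1 : ℝ) ≤ 1 + (n : ℝ) ^ 2 := by nlinarith [sq_nonneg (n : ℝ)]
    have hKM : ∀ x : ℝ, 0 ≤ x → 4 * K * x ≤ 4 * K * (1 + (n : ℝ) ^ 2) * x := by
      intro x hx
      rw [mul_assoc (4 * K)]
      refine mul_le_mul_of_nonneg_left ?_ (by positivity)
      nlinarith
    have hEn : E ≤ (n : ℝ) ^ 2 := hEle.trans (by gcongr)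
    have hKE : 0 ≤ K * E := by positivity
    have hKΛT : 0 ≤ K * (Λ * T) := by positivity
    refine ⟨?_, ?_, ?_, ?_⟩
    · refine le_trans ?_ (hKM _ (by positivity))
      have : L (n + 1) ^ 2 ≤ (L n + τ n) ^ 2 := pow_le_pow_left₀ (hL _) (hL' n) 2
      nlinarith [sq_nonneg (L n - τ n), mul_nonneg hK0 hΛ0, mul_nonneg hK0 hT0,
        mul_le_mul_of_nonneg_right hK hT0]
    · have hbsq : b n ^ 2 ≤ 2 * K * (1 + (n : ℝ) ^ 2) * Λ := by
        have : b n ^ 2 ≤ (L n + r n) ^ 2 := pow_le_pow_left₀ (hb _) (hb' n) 2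
        have h5 : K * (E * Λ) ≤ K * ((n : ℝ) ^ 2 * Λ) := by gcongr
        nlinarith [sq_nonneg (L n - r n)]
      have : t (n + 1) ^ 2 ≤ (t n + b n * τ n) ^ 2 := pow_le_pow_left₀ (ht _) (ht' n) 2
      have h6 : (b n * τ n) ^ 2 ≤ 2 * K * (1 + (n : ℝ) ^ 2) * Λ * T := by
        rw [mul_pow]
        exact mul_le_mul_of_nonneg_right hbsq hT0
      have h7 := hKM E hE0
      nlinarith [sq_nonneg (t n - b n * τ n)]
    · refine le_trans ?_ (hKM _ (by positivity))
      have : r (n + 1) ^ 2 ≤ (r n + t n * τ n) ^ 2 := pow_le_pow_left₀ (hr _) (hr' n) 2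
      have h6 : (t n * τ n) ^ 2 ≤ K * E * T := by
        rw [mul_pow]
        exact mul_le_mul_of_nonneg_right i2 hT0
      have h7 : 0 ≤ K * (Λ * T) * (Λ + T) := by positivity
      have h8 : 0 ≤ K * E * Λ := by positivity
      have h9 : 0 ≤ K * E * T := by positivity
      nlinarith [sq_nonneg (r n - t n * τ n)]
    · refine le_trans ?_ (hKM _ hE'0)
      have h5 : L (n + 1) * r (n + 1) ≤ (L n + τ n) * (r n + t n * τ n) :=
        mul_le_mul (hL' n) (hr' n) (hr _) (add_nonneg (hL n) (hτ n))
      have hKK : K ≤ K ^ 2 := by nlinarith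
      have h6 : τ n * r n ≤ K * E' := by
        refine le_of_sq_le_sq ?_ (by positivity)
        have : (τ n * r n) ^ 2 ≤ T * (K * (E * Λ)) := by
          rw [mul_pow]
          exact mul_le_mul_of_nonneg_left i3 hT0
        have h7 : E * (Λ * T) ≤ E' ^ 2 := by nlinarith [mul_nonneg hE0 hΛT, sq_nonneg E, sq_nonneg (Λ * T)]
        calc (τ n * r n) ^ 2 ≤ K * (E * (Λ * T)) := by linarith
          _ ≤ K ^ 2 * E' ^ 2 := by gcongr
          _ = (K * E') ^ 2 := by ring
      have h7 : t n * T ≤ K * E' := by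
        refine le_of_sq_le_sq ?_ (by positivity)
        calc (t n * T) ^ 2 ≤ K * E * T ^ 2 := by
              rw [mul_pow]
              gcongr
          _ ≤ K * Λ ^ 2 * T ^ 2 := by gcongr
          _ = K * (Λ * T) ^ 2 := by ring
          _ ≤ K ^ 2 * E' ^ 2 := by gcongr; linarith
          _ = (K * E') ^ 2 := by ring
      have h8 : (L n * τ n) ^ 2 ≤ K * Λ * T := by
        rw [mul_pow]
        exact mul_le_mul_of_nonneg_right i1 hT0
      have h9 : τ n * (t n * τ n) = t n * T := by rw [hT]; ring
      have h10 : 2 * (t n * (L n * τ n)) ≤ K * E + K * Λ * T := by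
        linarith [sq_nonneg (t n - L n * τ n)]
      have h11 : L (n + 1) * r (n + 1)
          ≤ L n * r n + t n * (L n * τ n) + τ n * r n + τ n * (t n * τ n) := by linarith
      have h12 : K * E' = K * E + K * Λ * T := by rw [hE']; ring
      have h13 : 0 ≤ K * Λ * T := by positivity
      linarith

/-- The product expansion around its linear part, for matrices in `SU(1,1)`. -/
theorem exists_norm_sq_su11Prod_le (n : ℕ) : ∃ K : ℝ, 0 ≤ K ∧ ∀ α β : ℕ → ℂ,
    (∀ l, ‖α l‖ ^ 2 - ‖β l‖ ^ 2 = 1) →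
    ‖(su11Prod α β n).2‖ ^ 2 ≤
      ‖(∏ l ∈ Finset.range n, α l) * ∑ k ∈ Finset.range n,
        conj (∏ l ∈ Finset.range k, α l) / (∏ l ∈ Finset.range (k + 1), α l) * β k‖ ^ 2 +
      K * pairSum (fun l => ‖β l‖ ^ 2 / ‖α l‖ ^ 2) n * ∏ l ∈ Finset.range n, ‖α l‖ ^ 2 := by
  obtain ⟨K, hK, h⟩ := exists_expansion_bound n
  -- In `(L + r)²` the cross term contributes `2K`, and `r² ≤ K E Λ` with `Λ ≤ n` contributes `n K`.
  refine ⟨(2 + n) * K, by positivity, fun α β hαβ => ?_⟩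
  have hα1 : ∀ l, 1 ≤ ‖α l‖ := fun l => by
    nlinarith [hαβ l, sq_nonneg ‖β l‖, norm_nonneg (α l)]
  have hα0 : ∀ l, 0 < ‖α l‖ := fun l => by linarith [hα1 l]
  have hαne : ∀ l, α l ≠ 0 := fun l => norm_pos_iff.1 (hα0 l)
  -- `A` is the part of `a` free of the off-diagonal entries and `L` the part of `b` of first order
  -- in them. Dividing all quantities by `‖A m‖` puts the recurrences in the form of
  -- `exists_expansion_bound`, with `τ l = ‖β l‖ / ‖α l‖ ≤ 1`.
  set A : ℕ → ℂ := fun m => ∏ l ∈ Finset.range m, α l with hA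
  have hAs : ∀ m, A (m + 1) = A m * α m := fun m => Finset.prod_range_succ _ _
  have hAne : ∀ m, A m ≠ 0 := fun m => Finset.prod_ne_zero_iff.2 fun l _ => hαne l
  have hA0 : ∀ m, 0 < ‖A m‖ := fun m => norm_pos_iff.2 (hAne m)
  set L : ℕ → ℂ := fun m => A m * ∑ k ∈ Finset.range m, conj (A k) / A (k + 1) * β k with hL
  have hLs : ∀ m, L (m + 1) = L m * α m + conj (A m) * β m := by
    intro m
    simp only [hL]
    rw [Finset.sum_range_succ, mul_add]
    congr 1
    · rw [hAs]; ring
    · field_simp [hAne (m + 1)]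
  set a : ℕ → ℂ := fun m => (su11Prod α β m).1 with ha
  set b : ℕ → ℂ := fun m => (su11Prod α β m).2 with hb
  have has : ∀ m, a (m + 1) = a m * α m + conj (b m) * β m := fun m => rfl
  have hbs : ∀ m, b (m + 1) = b m * α m + conj (a m) * β m := fun m => rfl
  have hdiv : ∀ (m : ℕ) (x y z w : ℂ), x = y * α m + z * w →
      ‖x‖ / ‖A (m + 1)‖ ≤ ‖y‖ / ‖A m‖ + ‖z‖ / ‖A m‖ * (‖w‖ / ‖α m‖) := by
    intro m x y z w hx
    rw [hx, hAs, norm_mul, div_le_iff₀ (mul_pos (hA0 m) (hα0 m))]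
    refine (norm_add_le _ _).trans_eq ?_
    rw [norm_mul, norm_mul]
    have h1 := (hA0 m).ne'
    have h2 := (hα0 m).ne'
    field_simp
  obtain ⟨-, -, h3, h4⟩ := h (fun l => ‖β l‖ / ‖α l‖) (fun m => ‖a m - A m‖ / ‖A m‖)
    (fun m => ‖b m - L m‖ / ‖A m‖) (fun m => ‖L m‖ / ‖A m‖) (fun m => ‖b m‖ / ‖A m‖)
    (fun l => by positivity)
    (fun l => by
      rw [div_le_one (hα0 l)]
      exact le_of_sq_le_sq (by linarith [hαβ l]) (norm_nonneg _))
    (fun l => by positivity) (fun l => by positivity) (fun l => by positivity)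
    (fun l => by positivity) (by simp [ha, hA, su11Prod]) (by simp [hb, hL, su11Prod])
    (by simp [hL])
    (fun m => by
      refine (hdiv m _ (a m - A m) (conj (b m)) (β m) ?_).trans_eq ?_
      · rw [has, hAs]; ring
      · rw [RCLike.norm_conj])
    (fun m => by
      refine (hdiv m _ (b m - L m) (conj (a m - A m)) (β m) ?_).trans_eq ?_
      · rw [hbs, hLs, map_sub]; ring
      · rw [RCLike.norm_conj])
    (fun m => by
      refine (hdiv m _ (L m) (conj (A m)) (β m) (hLs m)).trans_eq ?_
      rw [RCLike.norm_conj, div_self (hA0 m).ne', one_mul])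
    (fun m => by
      rw [← add_div]
      gcongr
      calc ‖b m‖ = ‖L m + (b m - L m)‖ := by rw [add_sub_cancel]
        _ ≤ _ := norm_add_le _ _)
  simp only [div_pow] at h3 h4
  set E := pairSum (fun l => ‖β l‖ ^ 2 / ‖α l‖ ^ 2) n
  have hE0 : 0 ≤ E := pairSum_nonneg (fun l => by positivity) n
  have hΛn : ∑ l ∈ Finset.range n, ‖β l‖ ^ 2 / ‖α l‖ ^ 2 ≤ n := by
    refine (Finset.sum_le_card_nsmul _ _ 1 fun l _ => ?_).trans_eq (by simp)
    rw [div_le_one (by have := hα0 l; positivity)]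
    linarith [hαβ l]
  have hAn : ∏ l ∈ Finset.range n, ‖α l‖ ^ 2 = ‖A n‖ ^ 2 := by
    rw [hA, norm_prod, Finset.prod_pow]
  rw [hAn]
  change ‖b n‖ ^ 2 ≤ ‖L n‖ ^ 2 + _
  have hb1 : ‖b n‖ ≤ ‖L n‖ + ‖b n - L n‖ := by
    calc ‖b n‖ = ‖L n + (b n - L n)‖ := by rw [add_sub_cancel]
      _ ≤ _ := norm_add_le _ _
  have h3' : ‖b n - L n‖ ^ 2 ≤ n * K * E * ‖A n‖ ^ 2 := by
    rw [← div_le_iff₀ (by have := hA0 n; positivity)]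
    refine h3.trans ?_
    calc _ ≤ K * (E * n) := by gcongr
      _ = _ := by ring
  have h4' : ‖L n‖ * ‖b n - L n‖ ≤ K * E * ‖A n‖ ^ 2 := by
    rw [← div_le_iff₀ (by have := hA0 n; positivity), sq, mul_div_mul_comm]
    exact h4
  have h5 : ‖b n‖ ^ 2 ≤ (‖L n‖ + ‖b n - L n‖) ^ 2 := pow_le_pow_left₀ (norm_nonneg _) hb1 2
  nlinarith

/-- The local inequality at one node of the `d`-adic tree: for a product of `d` matrices in `SU(1,1)`
with rotated off-diagonal entries, the size `log (1 + c |b|²)` is dominated by the square of a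
trigonometric polynomial with damped off-diagonal terms. -/
def NodeInequality (d : ℕ) (c : ℝ) : Prop :=
  ∀ α β : ℕ → ℂ,
    (∀ l, ‖α l‖ ^ 2 - ‖β l‖ ^ 2 = 1) → ∃ γ : ℕ → ℂ,
      (∀ l < d, ‖γ l‖ ^ 2 ≤ Real.log (1 + c * ‖β l‖ ^ 2)) ∧
      ∀ z : ℂ, ‖z‖ = 1 →
        Real.log (1 + c * ‖(su11Prod α (fun l => z ^ l * β l) d).2‖ ^ 2) ≤
          ∑ l ∈ Finset.range d, Real.log (1 + c * ‖β l‖ ^ 2) +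
          ‖∑ l ∈ Finset.range d, z ^ l * γ l‖ ^ 2 - ∑ l ∈ Finset.range d, ‖γ l‖ ^ 2

/-- With `P = ∏ (1 + c |β l|²)`, the tangent line of `log` at `P` reduces the claim to an inequality
between `|b|²`, its linear part and `P`. The linear part supplies `γ`; the remainder is of the order
of the second symmetric polynomial of `T l = |β l|² / |α l|²`, and for large `c` the second-order
term of `P` absorbs it. -/
theorem exists_nodeInequality (d : ℕ) : ∃ c : ℝ, 1 ≤ c ∧ NodeInequality d c := by
  obtain ⟨K, hK, h⟩ := exists_norm_sq_su11Prod_le d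
  refine ⟨2 * K + 3, by linarith, fun α β hαβ => ?_⟩
  set κ : ℝ := 2 * K + 2 with hκ
  set c : ℝ := 2 * K + 3 with hc
  have hcκ : c = κ + 1 := by rw [hc, hκ]; ring
  have hc0 : 0 < c := by rw [hc]; positivity
  have hα1 : ∀ l, 1 ≤ ‖α l‖ ^ 2 := fun l => by nlinarith [hαβ l, sq_nonneg ‖β l‖]
  have hα0 : ∀ l, 0 < ‖α l‖ ^ 2 := fun l => by linarith [hα1 l]
  have hαne : ∀ l, α l ≠ 0 := fun l h0 => by simpa [h0] using hα0 l
  set P : ℝ := ∏ l ∈ Finset.range d, (1 + c * ‖β l‖ ^ 2) with hP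
  have hP0 : 0 < P := Finset.prod_pos fun l _ => by positivity
  set Q : ℝ := ∏ l ∈ Finset.range d, ‖α l‖ ^ 2 with hQ
  have hQ0 : 0 < Q := Finset.prod_pos fun l _ => hα0 l
  set T : ℕ → ℝ := fun l => ‖β l‖ ^ 2 / ‖α l‖ ^ 2 with hT
  have hT0 : ∀ l, 0 ≤ T l := fun l => by positivity
  have hT1 : ∀ l, T l ≤ 1 := fun l => by
    rw [hT]
    exact (div_le_one (hα0 l)).2 (by linarith [hαβ l])
  have hTα : ∀ l, T l * ‖α l‖ ^ 2 = ‖β l‖ ^ 2 := fun l => div_mul_cancel₀ _ (hα0 l).ne'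
  set E := pairSum T d with hE
  have hE0 : 0 ≤ E := pairSum_nonneg hT0 d
  -- Divide by `Q`: `1 / Q = ∏ (1 - T l)` and `P / Q = ∏ (1 + κ T l)`. Since `c = κ + 1`, the
  -- first-order terms cancel exactly, and the second-order ones need `1 + c K ≤ κ²`, which fixes
  -- the choice of `κ`.
  have key : 1 + c * (K * E * Q) + c * Q * ∑ l ∈ Finset.range d, T l ≤ P := by
    have h1 := prod_one_sub_le hT0 hT1 d
    have h2 := le_prod_one_add_mul hT0 (κ := κ) (by positivity) d
    have h3 : (∏ l ∈ Finset.range d, (1 - T l)) * Q = 1 := by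
      rw [hQ, ← Finset.prod_mul_distrib]
      refine Finset.prod_eq_one fun l _ => ?_
      rw [sub_mul, hTα]
      linarith [hαβ l]
    have h4 : (∏ l ∈ Finset.range d, (1 + κ * T l)) * Q = P := by
      rw [hQ, hP, ← Finset.prod_mul_distrib]
      refine Finset.prod_congr rfl fun l _ => ?_
      rw [add_mul, mul_assoc, hTα, hcκ]
      linarith [hαβ l]
    have h5 : (1 + c * K) * E ≤ κ ^ 2 * E := by
      refine mul_le_mul_of_nonneg_right ?_ hE0
      rw [hc, hκ]
      nlinarith
    rw [← h3, ← h4]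
    have h6 : ∏ l ∈ Finset.range d, (1 - T l) + c * (K * E) + c * ∑ l ∈ Finset.range d, T l
        ≤ ∏ l ∈ Finset.range d, (1 + κ * T l) := by
      rw [hcκ] at h5 ⊢
      nlinarith
    calc _ = (∏ l ∈ Finset.range d, (1 - T l) + c * (K * E) + c * ∑ l ∈ Finset.range d, T l) * Q :=
          by ring
      _ ≤ _ := mul_le_mul_of_nonneg_right h6 hQ0.le
  set A : ℕ → ℂ := fun m => ∏ l ∈ Finset.range m, α l with hA
  have hAne : ∀ m, A m ≠ 0 := fun m => Finset.prod_ne_zero_iff.2 fun l _ => hαne l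
  have hAQ : ‖A d‖ ^ 2 = Q := by rw [hA, norm_prod, ← Finset.prod_pow]
  -- The coefficient of `z ^ k` in the linear part, scaled by the slope `1 / P` of `log` at `P`.
  set γ : ℕ → ℂ := fun k => (Real.sqrt (c / P) : ℝ) * (A d * (conj (A k) / A (k + 1) * β k))
    with hγ
  have hγn : ∀ k, ‖γ k‖ ^ 2 = c / P * (Q * T k) := by
    intro k
    have hk : ‖conj (A k) / A (k + 1)‖ = ‖α k‖⁻¹ := by
      have : A (k + 1) = A k * α k := Finset.prod_range_succ _ _
      rw [this, norm_div, norm_mul, RCLike.norm_conj]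
      have := norm_ne_zero_iff.2 (hAne k)
      have := norm_ne_zero_iff.2 (hαne k)
      field_simp
    rw [hγ, norm_mul, norm_mul, norm_mul, hk, Complex.norm_real, Real.norm_eq_abs, mul_pow, mul_pow,
      mul_pow, sq_abs, Real.sq_sqrt (by positivity), hAQ, inv_pow, ← div_eq_inv_mul]
  refine ⟨γ, fun l hl => ?_, fun z hz => ?_⟩
  · have hmem : l ∈ Finset.range d := Finset.mem_range.2 hl
    have h1 : Q * T l * (1 + c * ‖β l‖ ^ 2) ≤ ‖β l‖ ^ 2 * P := by
      rw [hQ, hP, ← Finset.mul_prod_erase _ _ hmem, ← Finset.mul_prod_erase _ _ hmem]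
      have h2 : ∏ x ∈ (Finset.range d).erase l, ‖α x‖ ^ 2
          ≤ ∏ x ∈ (Finset.range d).erase l, (1 + c * ‖β x‖ ^ 2) := by
        refine Finset.prod_le_prod (fun x _ => (hα0 x).le) fun x _ => ?_
        have : ‖β x‖ ^ 2 ≤ c * ‖β x‖ ^ 2 :=
          le_mul_of_one_le_left (sq_nonneg _) (by rw [hc]; linarith)
        linarith [hαβ x]
      calc _ = ‖β l‖ ^ 2 * (1 + c * ‖β l‖ ^ 2) * ∏ x ∈ (Finset.range d).erase l, ‖α x‖ ^ 2 := by
            rw [← hTα]; ring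
        _ ≤ ‖β l‖ ^ 2 * (1 + c * ‖β l‖ ^ 2) *
            ∏ x ∈ (Finset.range d).erase l, (1 + c * ‖β x‖ ^ 2) := by gcongr
        _ = _ := by ring
    have hpos : 0 < 1 + c * ‖β l‖ ^ 2 := by positivity
    -- The damping: since `|α x|² ≤ 1 + c |β x|²` for `x ≠ l`, `|γ l|²` is at most `1 - 1 / (1 + c
    -- |β l|²)`.
    refine le_trans ?_ (Real.one_sub_inv_le_log_of_pos hpos)
    rw [hγn, div_mul_eq_mul_div, div_le_iff₀ hP0, one_sub_mul, inv_mul_eq_div, ← sub_nonneg]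
    have : P - P / (1 + c * ‖β l‖ ^ 2) - c * (Q * T l) =
        c * (‖β l‖ ^ 2 * P - Q * T l * (1 + c * ‖β l‖ ^ 2)) / (1 + c * ‖β l‖ ^ 2) := by
      field_simp
      ring
    rw [this]
    exact div_nonneg (mul_nonneg hc0.le (sub_nonneg.2 h1)) hpos.le
  · have hzn : ∀ l, ‖z ^ l * β l‖ = ‖β l‖ := fun l => by rw [norm_mul, norm_pow, hz]; simp
    have hb := h α (fun l => z ^ l * β l) (fun l => by rw [hzn]; exact hαβ l)
    simp only [hzn] at hb
    set b := (su11Prod α (fun l => z ^ l * β l) d).2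
    set L : ℂ := A d * ∑ k ∈ Finset.range d, conj (A k) / A (k + 1) * (z ^ k * β k) with hL
    change ‖b‖ ^ 2 ≤ ‖L‖ ^ 2 + K * E * Q at hb
    have hγL : ‖∑ l ∈ Finset.range d, z ^ l * γ l‖ ^ 2 = c / P * ‖L‖ ^ 2 := by
      have : ∑ l ∈ Finset.range d, z ^ l * γ l = (Real.sqrt (c / P) : ℝ) * L := by
        rw [hL, Finset.mul_sum, Finset.mul_sum]
        refine Finset.sum_congr rfl fun l _ => ?_
        rw [hγ]
        ring
      rw [this, norm_mul, Complex.norm_real, Real.norm_eq_abs, mul_pow, sq_abs,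
        Real.sq_sqrt (by positivity)]
    rw [hγL, Finset.sum_congr rfl fun l _ => hγn l, ← Real.log_prod (fun l _ => by positivity),
      ← hP, ← Finset.mul_sum, ← Finset.mul_sum]
    have h1 : 0 < 1 + c * ‖b‖ ^ 2 := by positivity
    have h2 : Real.log (1 + c * ‖b‖ ^ 2) ≤ Real.log P + ((1 + c * ‖b‖ ^ 2) / P - 1) := by
      have := Real.log_le_sub_one_of_pos (div_pos h1 hP0)
      rw [Real.log_div h1.ne' hP0.ne'] at this
      linarith
    have h3 : (1 + c * ‖b‖ ^ 2) / P - 1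
        ≤ c / P * ‖L‖ ^ 2 - c / P * (Q * ∑ l ∈ Finset.range d, T l) := by
      rw [div_mul_eq_mul_div, div_mul_eq_mul_div, ← sub_div, div_sub_one hP0.ne']
      refine div_le_div_of_nonneg_right ?_ hP0.le
      have := mul_le_mul_of_nonneg_left hb hc0.le
      linarith
    linarith

open scoped BoundedContinuousFunction

/-! ### Existence of solutions by a contraction in a weighted norm. -/

section Existence

variable {w : ℝ → ℂ}

/-- The total variation of the potential on `[0, x]`. -/
def potentialMass (w : ℝ → ℂ) (x : ℝ) : ℝ := ∫ t in (0 : ℝ)..max x 0, ‖w t‖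

theorem potentialMass_of_nonneg {x : ℝ} (hx : 0 ≤ x) :
    potentialMass w x = ∫ t in (0 : ℝ)..x, ‖w t‖ := by
  rw [potentialMass, max_eq_left hx]

theorem potentialMass_nonneg (x : ℝ) : 0 ≤ potentialMass w x :=
  intervalIntegral.integral_nonneg (le_max_right _ _) fun _ _ => norm_nonneg _

theorem continuous_potentialMass (hw : Integrable w) : Continuous (potentialMass w) :=
  (intervalIntegral.continuous_primitive (fun _ _ => hw.norm.intervalIntegrable) 0).comp
    (continuous_id.max continuous_const)

theorem potentialMass_mono (hw : Integrable w) : Monotone (potentialMass w) := by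
  intro x y hxy
  refine intervalIntegral.integral_mono_interval le_rfl (le_max_right _ _)
    (max_le_max_right 0 hxy) (Eventually.of_forall fun _ => norm_nonneg _)
    hw.norm.intervalIntegrable

theorem potentialMass_le (hw : Integrable w) (x : ℝ) : potentialMass w x ≤ ∫ t, ‖w t‖ := by
  rw [potentialMass, intervalIntegral.integral_of_le (le_max_right _ _)]
  exact setIntegral_le_integral hw.norm (Eventually.of_forall fun _ => norm_nonneg _)

/-- The integrand is half the almost everywhere derivative of `exp (2 m)`. This function is
absolutely continuous because the exponential is Lipschitz on the bounded range of `m`. It makes the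
weighted Volterra operator contract by `1/2` without any smallness of `w`. -/
theorem integral_exp_potentialMass (hw : Integrable w) {x : ℝ} (hx : 0 ≤ x) :
    ∫ t in (0 : ℝ)..x, Real.exp (2 * potentialMass w t) * ‖w t‖
      = (Real.exp (2 * potentialMass w x) - 1) / 2 := by
  set M := ∫ t, ‖w t‖
  obtain ⟨K, hK⟩ : ∃ K, LipschitzOnWith K (fun s : ℝ => Real.exp (2 * s)) (Icc 0 M) := by
    have : ContDiff ℝ 1 (fun s : ℝ => Real.exp (2 * s)) := by fun_prop
    exact this.contDiffOn.exists_lipschitzOnWith one_ne_zero (convex_Icc 0 M) isCompact_Icc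
  have hint : IntervalIntegrable (fun t => ‖w t‖) volume 0 x := hw.norm.intervalIntegrable
  have hm := hint.absolutelyContinuousOnInterval_intervalIntegral left_mem_uIcc
  have hac := AbsolutelyContinuousOnInterval.lipschitzOn_comp hK hm (by
    intro t ht
    rw [uIcc_of_le hx] at ht
    simp only [← potentialMass_of_nonneg (w := w) ht.1]
    exact ⟨potentialMass_nonneg t, potentialMass_le hw t⟩)
  have h := hac.integral_deriv_eq_sub
  have e : ∫ t in (0 : ℝ)..x, deriv (fun x => Real.exp (2 * ∫ v in (0 : ℝ)..x, ‖w v‖)) t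
      = ∫ t in (0 : ℝ)..x, 2 * (Real.exp (2 * potentialMass w t) * ‖w t‖) := by
    refine intervalIntegral.integral_congr_ae ?_
    filter_upwards [hint.ae_hasDerivAt_integral] with t ht htx
    have h1 := ((ht (uIoc_subset_uIcc htx) 0 left_mem_uIcc).const_mul 2).exp
    rw [h1.deriv, potentialMass_of_nonneg]
    · ring
    · rw [uIoc_of_le hx] at htx
      exact htx.1.le
  rw [e, intervalIntegral.integral_const_mul, ← potentialMass_of_nonneg hx] at h
  simp only [intervalIntegral.integral_same, mul_zero, Real.exp_zero] at h
  linarith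

theorem integrable_exp_mul_conj_mul (hw : Integrable w) (u : ℝ →ᵇ ℂ) :
    Integrable fun t => (Real.exp (2 * potentialMass w t) : ℂ) * conj (u t) * w t := by
  have hc := continuous_potentialMass hw
  refine hw.bdd_mul (c := Real.exp (2 * ∫ t, ‖w t‖) * ‖u‖) ?_ (Eventually.of_forall fun t => ?_)
  · have : Continuous fun t => (Real.exp (2 * potentialMass w t) : ℂ) * conj (u t) := by
      have := u.continuous
      fun_prop
    exact this.aestronglyMeasurable
  · rw [norm_mul, RCLike.norm_conj, Complex.norm_real, Real.norm_eq_abs, Real.abs_exp]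
    gcongr
    · exact potentialMass_le hw t
    · exact u.norm_coe_le_norm t

theorem norm_integral_exp_mul_le (hw : Integrable w) (u : ℝ →ᵇ ℂ) (x : ℝ) :
    ‖(Real.exp (-(2 * potentialMass w x)) : ℂ) * ∫ t in (0 : ℝ)..max x 0,
      (Real.exp (2 * potentialMass w t) : ℂ) * conj (u t) * w t‖ ≤ ‖u‖ / 2 := by
  have hc := continuous_potentialMass hw
  have h0 : (0 : ℝ) ≤ max x 0 := le_max_right _ _
  have h1 : ‖∫ t in (0 : ℝ)..max x 0, (Real.exp (2 * potentialMass w t) : ℂ) * conj (u t) * w t‖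
      ≤ ∫ t in (0 : ℝ)..max x 0, ‖u‖ * (Real.exp (2 * potentialMass w t) * ‖w t‖) := by
    refine intervalIntegral.norm_integral_le_of_norm_le h0 (Eventually.of_forall fun t _ => ?_) ?_
    · rw [norm_mul, norm_mul, RCLike.norm_conj, Complex.norm_real, Real.norm_eq_abs, Real.abs_exp]
      have := u.norm_coe_le_norm t
      calc _ ≤ Real.exp (2 * potentialMass w t) * ‖u‖ * ‖w t‖ := by gcongr
        _ = _ := by ring
    · refine IntervalIntegrable.const_mul ?_ _
      refine (hw.norm.intervalIntegrable).continuousOn_mul ?_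
      exact Continuous.continuousOn (by fun_prop)
  rw [intervalIntegral.integral_const_mul, integral_exp_potentialMass hw h0] at h1
  have h2 : potentialMass w (max x 0) = potentialMass w x := by simp [potentialMass]
  rw [h2] at h1
  rw [norm_mul, Complex.norm_real, Real.norm_eq_abs, Real.abs_exp]
  calc _ ≤ Real.exp (-(2 * potentialMass w x)) *
        (‖u‖ * ((Real.exp (2 * potentialMass w x) - 1) / 2)) := by gcongr
    _ = ‖u‖ / 2 * (1 - Real.exp (-(2 * potentialMass w x))) := by
        rw [Real.exp_neg]
        field_simp
    _ ≤ ‖u‖ / 2 := mul_le_of_le_one_right (by positivity)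
        (by linarith [Real.exp_pos (-(2 * potentialMass w x))])

/-- The weighted Volterra operator `u ↦ e^{-2m(x)} ∫₀ˣ e^{2m(t)} conj (u t) w t dt`. -/
def volterra (hw : Integrable w) (u : ℝ →ᵇ ℂ) : ℝ →ᵇ ℂ :=
  BoundedContinuousFunction.ofNormedAddCommGroup
    (fun x => (Real.exp (-(2 * potentialMass w x)) : ℂ) * ∫ t in (0 : ℝ)..max x 0,
      (Real.exp (2 * potentialMass w t) : ℂ) * conj (u t) * w t)
    (by
      have hc := continuous_potentialMass hw
      have h1 : Continuous fun x : ℝ => ∫ t in (0 : ℝ)..max x 0,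
          (Real.exp (2 * potentialMass w t) : ℂ) * conj (u t) * w t :=
        (intervalIntegral.continuous_primitive (fun _ _ =>
          (integrable_exp_mul_conj_mul hw u).intervalIntegrable) 0).comp
          (continuous_id.max continuous_const)
      fun_prop) (‖u‖ / 2) (norm_integral_exp_mul_le hw u)

theorem norm_volterra_le (hw : Integrable w) (u : ℝ →ᵇ ℂ) : ‖volterra hw u‖ ≤ ‖u‖ / 2 :=
  BoundedContinuousFunction.norm_ofNormedAddCommGroup_le _ (by positivity)
    (norm_integral_exp_mul_le hw u)

theorem volterra_sub (hw : Integrable w) (u v : ℝ →ᵇ ℂ) :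
    volterra hw (u - v) = volterra hw u - volterra hw v := by
  ext x
  simp only [volterra, BoundedContinuousFunction.coe_ofNormedAddCommGroup,
    BoundedContinuousFunction.coe_sub, Pi.sub_apply]
  rw [← mul_sub, ← intervalIntegral.integral_sub
    (integrable_exp_mul_conj_mul hw u).intervalIntegrable
    (integrable_exp_mul_conj_mul hw v).intervalIntegrable]
  congr 1
  refine intervalIntegral.integral_congr fun t _ => ?_
  simp only [map_sub]
  ring

/-- Existence of solutions for integrable potentials, with a bound for the off-diagonal entry. -/
theorem exists_isDiracFlow (hw : Integrable w) : ∃ a b : ℝ → ℂ, IsDiracFlow w a b ∧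
    ∀ x, 0 ≤ x → ‖b x‖ ≤ 2 * Real.exp (2 * ∫ t in (0 : ℝ)..x, ‖w t‖) * ∫ t in (0 : ℝ)..x, ‖w t‖ := by
  have hc := continuous_potentialMass hw
  let e : ℝ →ᵇ ℂ := BoundedContinuousFunction.ofNormedAddCommGroup
    (fun x => (Real.exp (-(2 * potentialMass w x)) : ℂ)) (by fun_prop) 1 (fun x => by
      rw [Complex.norm_real, Real.norm_eq_abs, Real.abs_exp, Real.exp_le_one_iff]
      linarith [potentialMass_nonneg (w := w) x])
  have he : ‖e‖ ≤ 1 := BoundedContinuousFunction.norm_ofNormedAddCommGroup_le _ (by norm_num) _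
  -- The integral equations for `a` and `b` in the unknowns `u = exp (-2m) a`, `v = exp (-2m) b`.
  let Φ : (ℝ →ᵇ ℂ) × (ℝ →ᵇ ℂ) → (ℝ →ᵇ ℂ) × (ℝ →ᵇ ℂ) :=
    fun P => (e + volterra hw P.2, volterra hw P.1)
  have hΦ : ContractingWith (1 / 2) Φ := by
    refine ⟨by norm_num, LipschitzWith.of_dist_le_mul fun P Q => ?_⟩
    have h1 : ∀ u v, dist (volterra hw u) (volterra hw v) ≤ dist u v / 2 := fun u v => by
      rw [dist_eq_norm, dist_eq_norm, ← volterra_sub]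
      exact norm_volterra_le hw _
    have h2 := h1 P.1 Q.1
    have h3 := h1 P.2 Q.2
    simp only [Φ, Prod.dist_eq, dist_add_left]
    push_cast
    refine max_le ?_ ?_
    · linarith [le_max_right (dist P.1 Q.1) (dist P.2 Q.2)]
    · linarith [le_max_left (dist P.1 Q.1) (dist P.2 Q.2)]
  obtain ⟨⟨u, v⟩, huv⟩ : ∃ P, Φ P = P := ⟨_, hΦ.fixedPoint_isFixedPt⟩
  have hu : e + volterra hw v = u := congrArg Prod.fst huv
  have hv : volterra hw u = v := congrArg Prod.snd huv
  have hun : ‖u‖ ≤ 2 := by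
    have h1 : ‖u‖ ≤ ‖e‖ + ‖volterra hw v‖ := by rw [← hu]; exact norm_add_le _ _
    have h2 := norm_volterra_le hw v
    have h3 := norm_volterra_le hw u
    rw [hv] at h3
    linarith
  set a : ℝ → ℂ := fun x => (Real.exp (2 * potentialMass w x) : ℂ) * u x with ha
  set b : ℝ → ℂ := fun x => (Real.exp (2 * potentialMass w x) : ℂ) * v x with hb
  have hexp : ∀ x, (Real.exp (2 * potentialMass w x) : ℂ) * (Real.exp (-(2 * potentialMass w x)) : ℂ)
      = 1 := fun x => by
    rw [← Complex.ofReal_mul, ← Real.exp_add]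
    simp
  have hconj : ∀ (u : ℝ →ᵇ ℂ) t, conj ((Real.exp (2 * potentialMass w t) : ℂ) * u t) * w t
      = (Real.exp (2 * potentialMass w t) : ℂ) * conj (u t) * w t := fun u t => by
    rw [map_mul, Complex.conj_ofReal]
  have hia : Integrable fun t => conj (a t) * w t := by
    simp only [ha, hconj]
    exact integrable_exp_mul_conj_mul hw u
  have hib : Integrable fun t => conj (b t) * w t := by
    simp only [hb, hconj]
    exact integrable_exp_mul_conj_mul hw v
  have hae : ∀ x, 0 ≤ x → a x = 1 + ∫ t in (0 : ℝ)..x, conj (b t) * w t := by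
    intro x hx
    simp only [ha, hb, hconj]
    nth_rewrite 1 [← hu]
    simp only [BoundedContinuousFunction.coe_add, Pi.add_apply, e, volterra,
      BoundedContinuousFunction.coe_ofNormedAddCommGroup, max_eq_left hx]
    rw [mul_add, hexp, ← mul_assoc, hexp, one_mul]
  have hbe : ∀ x, 0 ≤ x → b x = ∫ t in (0 : ℝ)..x, conj (a t) * w t := by
    intro x hx
    simp only [ha, hb, hconj]
    nth_rewrite 1 [← hv]
    simp only [volterra, BoundedContinuousFunction.coe_ofNormedAddCommGroup, max_eq_left hx]
    rw [← mul_assoc, hexp, one_mul]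
  have hacI : ∀ (g h : ℝ → ℂ) (k : ℂ) (R : ℝ), 0 ≤ R → Integrable g →
      (∀ x, 0 ≤ x → h x = k + ∫ t in (0 : ℝ)..x, g t) →
      AbsolutelyContinuousOnInterval h 0 R := by
    intro g h k R hR hg hh
    refine Tendsto.congr' ?_
      (AbsolutelyContinuousOnInterval.intervalIntegral_complex (hg.intervalIntegrable (a := 0)
        (b := R)))
    rw [EventuallyEq, eventually_inf_principal]
    refine Eventually.of_forall fun E hE => Finset.sum_congr rfl fun i hi => ?_
    have h1 := (hE.1 i hi).1
    have h2 := (hE.1 i hi).2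
    rw [uIcc_of_le hR] at h1 h2
    rw [hh _ h1.1, hh _ h2.1, dist_add_left]
  have hder : ∀ (g h : ℝ → ℂ) (k : ℂ), Integrable g →
      (∀ x, 0 ≤ x → h x = k + ∫ t in (0 : ℝ)..x, g t) →
      ∀ᵐ x ∂(volume.restrict (Ici (0 : ℝ))), HasDerivAt h (g x) x := by
    intro g h k hg hh
    rw [ae_restrict_iff' measurableSet_Ici]
    -- The integral formula holds only on `[0, ∞)`, so the two-sided derivative is taken at `x > 0`.
    filter_upwards [LocallyIntegrable.ae_hasDerivAt_integral hg.locallyIntegrable,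
      (Set.countable_singleton (0 : ℝ)).ae_notMem volume] with x h1 h2 h3
    have hx : 0 < x := lt_of_le_of_ne h3 (Ne.symm h2)
    refine ((h1 0).const_add k).congr_of_eventuallyEq ?_
    filter_upwards [eventually_gt_nhds hx] with y hy using hh y hy.le
  have hbe' : ∀ x, 0 ≤ x → b x = 0 + ∫ t in (0 : ℝ)..x, conj (a t) * w t := fun x hx => by
    rw [zero_add]; exact hbe x hx
  refine ⟨a, b, ⟨by rw [hae 0 le_rfl]; simp, by rw [hbe 0 le_rfl]; simp,
    fun R hR => hacI _ a 1 R hR hib hae, fun R hR => hacI _ b 0 R hR hia hbe', ?_⟩, ?_⟩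
  · filter_upwards [hder _ a 1 hib hae, hder _ b 0 hia hbe'] with x h1 h2 using ⟨h1, h2⟩
  · intro x hx
    rw [hbe x hx, ← intervalIntegral.integral_const_mul]
    refine intervalIntegral.norm_integral_le_of_norm_le hx (Eventually.of_forall fun t ht => ?_)
      (hw.norm.intervalIntegrable.const_mul _)
    rw [norm_mul, RCLike.norm_conj, ha, norm_mul, Complex.norm_real, Real.norm_eq_abs, Real.abs_exp,
      ← potentialMass_of_nonneg hx, mul_comm (2 : ℝ) (Real.exp _)]
    gcongr
    · exact potentialMass_mono hw ht.2
    · exact (u.norm_coe_le_norm t).trans hun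

end Existence

/-! ### Digits and the Cantor character under refinement of the frequency. -/

section Digits

variable {d : ℕ}

theorem floor_natCast_mul_zpow (m n : ℕ) : ⌊(m : ℝ) * (d : ℝ) ^ (n : ℤ)⌋₊ = m * d ^ n := by
  rw [zpow_natCast]
  exact_mod_cast Nat.floor_natCast (R := ℝ) (m * d ^ n)

theorem floor_mul_zpow_neg (y : ℝ) (n : ℕ) :
    ⌊y * (d : ℝ) ^ (-(n : ℤ))⌋₊ = ⌊y⌋₊ / d ^ n := by
  rw [zpow_neg, zpow_natCast, ← div_eq_mul_inv, ← Nat.cast_pow, Nat.floor_div_natCast]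

theorem baseDigit_mul_zpow (hd : 2 ≤ d) (y : ℝ) (k i : ℤ) :
    baseDigit d (y * (d : ℝ) ^ (-k)) i = ⌊y * (d : ℝ) ^ (-k - i)⌋₊ % d := by
  have hd0 : (d : ℝ) ≠ 0 := by positivity
  rw [baseDigit, mul_assoc, ← zpow_add₀ hd0, sub_eq_add_neg]

theorem baseDigit_child_self (hd : 2 ≤ d) (m j : ℕ) (hj : j < d) (k : ℤ) :
    baseDigit d (((d * m + j : ℕ) : ℝ) * (d : ℝ) ^ (-(k + 1))) (-1 - k) = j := by
  rw [baseDigit_mul_zpow hd]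
  have : -(k + 1) - (-1 - k) = 0 := by ring
  rw [this, zpow_zero, mul_one, Nat.floor_natCast, Nat.mul_add_mod, Nat.mod_eq_of_lt hj]

theorem baseDigit_parent_eq_zero (hd : 2 ≤ d) (m : ℕ) (k : ℤ) :
    baseDigit d ((m : ℝ) * (d : ℝ) ^ (-k)) (-1 - k) = 0 := by
  rw [baseDigit_mul_zpow hd]
  have : -k - (-1 - k) = ((1 : ℕ) : ℤ) := by push_cast; ring
  rw [this, floor_natCast_mul_zpow, pow_one, Nat.mul_mod_left]

/-- Appending `j` changes only the digit of index `-1 - k`: lower digits vanish on both sides, and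
higher ones come from integer division, which discards `j`. -/
theorem baseDigit_child_of_ne (hd : 2 ≤ d) (m j : ℕ) (hj : j < d) {k i : ℤ} (hi : i ≠ -1 - k) :
    baseDigit d (((d * m + j : ℕ) : ℝ) * (d : ℝ) ^ (-(k + 1))) i
      = baseDigit d ((m : ℝ) * (d : ℝ) ^ (-k)) i := by
  rw [baseDigit_mul_zpow hd, baseDigit_mul_zpow hd]
  rcases lt_or_gt_of_ne hi with h | h
  · obtain ⟨n, hn⟩ := Int.eq_ofNat_of_zero_le (show 0 ≤ -1 - k - i - 1 by omega)
    have e1 : -(k + 1) - i = ((n + 1 : ℕ) : ℤ) := by push_cast; omega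
    have e2 : -k - i = ((n + 2 : ℕ) : ℤ) := by push_cast; omega
    rw [e1, e2, floor_natCast_mul_zpow, floor_natCast_mul_zpow, pow_succ d n,
      show n + 2 = (n + 1) + 1 from rfl, pow_succ d (n + 1), ← mul_assoc, ← mul_assoc,
      Nat.mul_mod_left, Nat.mul_mod_left]
  · obtain ⟨n, hn⟩ := Int.eq_ofNat_of_zero_le (show 0 ≤ i - (-1 - k) - 1 by omega)
    have e1 : -(k + 1) - i = -((n + 1 : ℕ) : ℤ) := by push_cast; omega
    have e2 : -k - i = -(n : ℤ) := by omega
    rw [e1, e2, floor_mul_zpow_neg, floor_mul_zpow_neg, Nat.floor_natCast, Nat.floor_natCast,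
      pow_succ', ← Nat.div_div_eq_div_mul, Nat.mul_add_div (by omega), Nat.div_eq_of_lt hj, add_zero]

/-- The appended digit has index `-1 - k`, so it meets only the digit `x_k`. -/
theorem digitPairing_child (hd : 2 ≤ d) (x : ℝ) (m j : ℕ) (hj : j < d) (k : ℤ) :
    digitPairing d x (((d * m + j : ℕ) : ℝ) * (d : ℝ) ^ (-(k + 1)))
      = digitPairing d x ((m : ℝ) * (d : ℝ) ^ (-k)) + j * baseDigit d x k := by
  have h : (fun n : ℤ => baseDigit d x n *
      baseDigit d (((d * m + j : ℕ) : ℝ) * (d : ℝ) ^ (-(k + 1))) (-1 - n)) =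
      fun n => baseDigit d x n * baseDigit d ((m : ℝ) * (d : ℝ) ^ (-k)) (-1 - n) +
        if n = k then j * baseDigit d x k else 0 := by
    funext n
    split_ifs with hn
    · subst hn
      rw [baseDigit_child_self hd m j hj, baseDigit_parent_eq_zero hd]
      ring
    · rw [baseDigit_child_of_ne hd m j hj (by omega), add_zero]
  rw [digitPairing, h, finsum_add_distrib (finite_support_baseDigit_mul d hd _ _)]
  · congr 1
    rw [finsum_eq_single _ k (fun n hn => if_neg hn), if_pos rfl]
  · refine (Set.finite_singleton k).subset fun n hn => ?_
    by_contra hne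
    exact hn (if_neg hne)

/-- The primitive `d`-th root of unity `exp (2 π i / d)`. -/
def rootOfUnity (d : ℕ) : ℂ := Complex.exp (2 * Real.pi * Complex.I / d)

theorem isPrimitiveRoot_rootOfUnity (hd : 2 ≤ d) : IsPrimitiveRoot (rootOfUnity d) d :=
  Complex.isPrimitiveRoot_exp d (by omega)

theorem cantorChar_eq_pow (x ξ : ℝ) : cantorChar d x ξ = rootOfUnity d ^ digitPairing d x ξ := by
  rw [cantorChar, rootOfUnity, ← Complex.exp_nat_mul, mul_comm]

theorem norm_cantorChar (hd : 2 ≤ d) (x ξ : ℝ) : ‖cantorChar d x ξ‖ = 1 := by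
  rw [cantorChar_eq_pow, norm_pow, (isPrimitiveRoot_rootOfUnity hd).norm'_eq_one (by omega), one_pow]

theorem baseDigit_of_mem (hd : 2 ≤ d) {x : ℝ} {n l : ℕ} (hl : l < d) {k : ℤ}
    (hx : ((d * n + l : ℕ) : ℝ) * (d : ℝ) ^ k ≤ x) (hx' : x < ((d * n + l + 1 : ℕ) : ℝ) * (d : ℝ) ^ k) :
    baseDigit d x k = l := by
  have hd0 : (0 : ℝ) < d := by positivity
  have hk : (0 : ℝ) < (d : ℝ) ^ k := zpow_pos hd0 k
  have : ⌊x * (d : ℝ) ^ (-k)⌋₊ = d * n + l := by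
    rw [zpow_neg, ← div_eq_mul_inv, Nat.floor_eq_iff, le_div_iff₀ hk, div_lt_iff₀ hk]
    · exact ⟨hx, by exact_mod_cast hx'⟩
    · exact div_nonneg (le_trans (by positivity) hx) hk.le
  rw [baseDigit, this, Nat.mul_add_mod, Nat.mod_eq_of_lt hl]

/-- Over a `d`-adic interval of length `d ^ k`, refining the frequency amounts to a constant
rotation. -/
theorem cantorChar_child (hd : 2 ≤ d) {x : ℝ} {n l : ℕ} (hl : l < d) (m j : ℕ) (hj : j < d) {k : ℤ}
    (hx : ((d * n + l : ℕ) : ℝ) * (d : ℝ) ^ k ≤ x) (hx' : x < ((d * n + l + 1 : ℕ) : ℝ) * (d : ℝ) ^ k) :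
    cantorChar d x (((d * m + j : ℕ) : ℝ) * (d : ℝ) ^ (-(k + 1)))
      = (rootOfUnity d ^ j) ^ l * cantorChar d x ((m : ℝ) * (d : ℝ) ^ (-k)) := by
  rw [cantorChar_eq_pow, cantorChar_eq_pow, digitPairing_child hd x m j hj,
    baseDigit_of_mem hd hl hx hx', pow_add, pow_mul, mul_comm]

/-- On `[0, d ^ K)` only the digits of `ξ` of index at least `-K` matter. -/
theorem cantorChar_floor (hd : 2 ≤ d) {x ξ : ℝ} {K : ℕ} (hx : x < (d : ℝ) ^ K) :
    cantorChar d x ((⌊ξ * (d : ℝ) ^ K⌋₊ : ℝ) * (d : ℝ) ^ (-(K : ℤ))) = cantorChar d x ξ := by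
  have hd0 : (0 : ℝ) < d := by positivity
  have hd1 : (1 : ℝ) ≤ d := by exact_mod_cast (by omega : 1 ≤ d)
  rw [cantorChar_eq_pow, cantorChar_eq_pow]
  congr 1
  refine finsum_congr fun n => ?_
  rcases le_or_gt (K : ℤ) n with hn | hn
  · have : baseDigit d x n = 0 := by
      rw [baseDigit, Nat.floor_eq_zero.2, Nat.zero_mod]
      rw [zpow_neg, ← div_eq_mul_inv, div_lt_one (zpow_pos hd0 n)]
      refine hx.trans_le ?_
      rw [← zpow_natCast]
      exact zpow_le_zpow_right₀ hd1 hn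
    rw [this, zero_mul, zero_mul]
  · obtain ⟨i, hi⟩ := Int.eq_ofNat_of_zero_le (show 0 ≤ (K : ℤ) - 1 - n by omega)
    rw [baseDigit_mul_zpow hd, baseDigit.eq_1 d ξ]
    have e1 : -(K : ℤ) - (-1 - n) = -(i : ℤ) := by omega
    have e2 : -(-1 - n) = (K : ℤ) + -(i : ℤ) := by omega
    rw [e1, e2, zpow_add₀ hd0.ne', ← mul_assoc, floor_mul_zpow_neg, floor_mul_zpow_neg,
      Nat.floor_natCast, zpow_natCast]

/-- The support of the pairing depends on `x`, so the pairing is treated as a pointwise limit of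
finite sums, eventually constant at each `x`. -/
theorem measurable_cantorChar (hd : 2 ≤ d) (ξ : ℝ) : Measurable fun x => cantorChar d x ξ := by
  have h1 : ∀ n : ℤ, Measurable fun x => baseDigit d x n := fun n => by
    unfold baseDigit
    exact (measurable_from_nat (f := fun m => m % d)).comp
      (Nat.measurable_floor.comp (measurable_id.mul_const _))
  have h2 : Measurable fun x => digitPairing d x ξ := by
    refine measurable_of_tendsto_metrizable (f := fun (N : ℕ) x => ∑ n ∈ Finset.Icc (-(N : ℤ)) N,
      baseDigit d x n * baseDigit d ξ (-1 - n)) (fun N => ?_) ?_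
    · exact Finset.measurable_fun_sum _ fun n _ => (h1 n).mul_const _
    · rw [tendsto_pi_nhds]
      intro x
      refine tendsto_const_nhds.congr' ?_
      have hfin := finite_support_baseDigit_mul d hd x ξ
      obtain ⟨N, hN⟩ : ∃ N : ℕ, ∀ n ∈ hfin.toFinset, n.natAbs ≤ N :=
        ⟨hfin.toFinset.sup Int.natAbs, fun n hn => Finset.le_sup (f := Int.natAbs) hn⟩
      filter_upwards [eventually_ge_atTop N] with M hM
      refine finsum_eq_sum_of_support_subset _ fun n hn => ?_
      have := hN n (hfin.mem_toFinset.2 hn)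
      rw [Finset.mem_coe, Finset.mem_Icc]
      omega
  simp_rw [cantorChar_eq_pow]
  exact (measurable_from_nat (f := fun m => rootOfUnity d ^ m)).comp h2

end Digits

/-! ### Climbing the `d`-adic tree. -/

section Tree

theorem Finset.sum_range_mul_eq {M : Type*} [AddCommMonoid M] (g : ℕ → M) (a d : ℕ) :
    ∑ m ∈ Finset.range (a * d), g m = ∑ m ∈ Finset.range a, ∑ j ∈ Finset.range d, g (d * m + j) := by
  induction a with
  | zero => simp
  | succ a ih => rw [Nat.succ_mul, Finset.sum_range_add, Finset.sum_range_succ, ih, mul_comm a d]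

theorem sum_rpow_sum_le {ι κ : Type*} (s : Finset ι) (t : Finset κ) {r : ℝ} (hr : 1 ≤ r)
    {g : κ → ι → ℝ} (hg : ∀ l i, 0 ≤ g l i) :
    (∑ i ∈ s, (∑ l ∈ t, g l i) ^ r) ^ (1 / r) ≤ ∑ l ∈ t, (∑ i ∈ s, g l i ^ r) ^ (1 / r) := by
  classical
  have hr0 : 0 < r := by linarith
  induction t using Finset.induction_on with
  | empty => simp [Real.zero_rpow hr0.ne', Real.zero_rpow (inv_ne_zero hr0.ne')]
  | insert a t ha ih =>
    simp_rw [Finset.sum_insert ha]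
    refine (Real.Lp_add_le_of_nonneg s hr (fun i _ => hg a i)
      (fun i _ => Finset.sum_nonneg fun l _ => hg l i)).trans ?_
    gcongr

/-- Iteration of a local Hausdorff–Young inequality along the `d`-adic tree of tiles. -/
theorem sum_rpow_le_of_forall_node {d : ℕ} {p q : ℝ} (hpq : p.HolderConjugate q) (hp : p ≤ 2)
    {F : ℕ → ℕ → ℕ → ℝ} (hF : ∀ i n m, 0 ≤ F i n m) {J : ℕ → ℕ → ℝ}
    (hnode : ∀ i n m, ∑ j ∈ Finset.range d, F (i + 1) n (d * m + j) ^ q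
      ≤ d * (∑ l ∈ Finset.range d, F i (d * n + l) m ^ p) ^ (q / p))
    (hJ : ∀ i n, ∑ l ∈ Finset.range d, J i (d * n + l) ≤ J (i + 1) n)
    (hbase : ∀ n, F 0 n 0 ^ p ≤ J 0 n) (i n : ℕ) :
    (∑ m ∈ Finset.range (d ^ i), F i n m ^ q) ^ (p / q) ≤ ((d : ℝ) ^ i) ^ (p / q) * J i n := by
  have hp0 : 0 < p := hpq.pos
  have hq0 : 0 < q := hpq.symm.pos
  have hd0 : (0 : ℝ) ≤ d := Nat.cast_nonneg d
  induction i generalizing n with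
  | zero =>
    have e : (F 0 n 0 ^ q) ^ (p / q) = F 0 n 0 ^ p := by
      rw [← Real.rpow_mul (hF _ _ _), mul_div_cancel₀ _ hq0.ne']
    simpa [e] using hbase n
  | succ i ih =>
    have hqp : p ≤ q := by
      have := hpq.inv_add_inv_eq_one
      have h2 : 2⁻¹ ≤ p⁻¹ := by gcongr
      rw [← inv_le_inv₀ hq0 hp0]
      linarith
    have hr : 1 ≤ q / p := (one_le_div hp0).2 hqp
    have h1 : ∑ m ∈ Finset.range (d ^ (i + 1)), F (i + 1) n m ^ q ≤
        d * ∑ m ∈ Finset.range (d ^ i), (∑ l ∈ Finset.range d, F i (d * n + l) m ^ p) ^ (q / p) := by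
      rw [pow_succ, Finset.sum_range_mul_eq, Finset.mul_sum]
      exact Finset.sum_le_sum fun m _ => hnode i n m
    -- Minkowski in the exponent `q / p ≥ 1`, which is where `p ≤ 2` enters: the sum over
    -- subintervals moves outside the norm over frequencies, and the induction hypothesis applies to
    -- each subinterval.
    have h2 := sum_rpow_sum_le (Finset.range (d ^ i)) (Finset.range d) hr
      (g := fun l m => F i (d * n + l) m ^ p) (fun l m => Real.rpow_nonneg (hF _ _ _) _)
    have e : ∀ l m, (F i (d * n + l) m ^ p) ^ (q / p) = F i (d * n + l) m ^ q := fun l m => by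
      rw [← Real.rpow_mul (hF _ _ _), mul_div_cancel₀ _ hp0.ne']
    simp only [e, one_div_div] at h2
    have hS0 : 0 ≤ ∑ m ∈ Finset.range (d ^ i),
        (∑ l ∈ Finset.range d, F i (d * n + l) m ^ p) ^ (q / p) :=
      Finset.sum_nonneg fun m _ => Real.rpow_nonneg (Finset.sum_nonneg fun l _ =>
        Real.rpow_nonneg (hF _ _ _) _) _
    calc (∑ m ∈ Finset.range (d ^ (i + 1)), F (i + 1) n m ^ q) ^ (p / q)
        ≤ (d * ∑ m ∈ Finset.range (d ^ i),
          (∑ l ∈ Finset.range d, F i (d * n + l) m ^ p) ^ (q / p)) ^ (p / q) := by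
          refine Real.rpow_le_rpow (Finset.sum_nonneg fun m _ => Real.rpow_nonneg (hF _ _ _) _) h1 ?_
          positivity
      _ ≤ (d : ℝ) ^ (p / q) * ∑ l ∈ Finset.range d,
          (∑ m ∈ Finset.range (d ^ i), F i (d * n + l) m ^ q) ^ (p / q) := by
          rw [Real.mul_rpow hd0 hS0]
          gcongr
      _ ≤ (d : ℝ) ^ (p / q) * ∑ l ∈ Finset.range d, ((d : ℝ) ^ i) ^ (p / q) * J i (d * n + l) := by
          gcongr with l hl
          exact ih _
      _ ≤ (d : ℝ) ^ (p / q) * (((d : ℝ) ^ i) ^ (p / q) * J (i + 1) n) := by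
          rw [← Finset.mul_sum]
          gcongr
          exact hJ i n
      _ = _ := by
          rw [pow_succ' (d : ℝ), Real.mul_rpow hd0 (by positivity), mul_assoc]

end Tree

/-! ### Scattering data of tiles: recursion and the L¹ bound. -/

section Cells

theorem sum_indicator_Ico {M : Type*} [AddCommMonoid M] {s : ℕ → ℝ} (hs : Monotone s) (g : ℝ → M)
    (x : ℝ) (n : ℕ) : ∑ l ∈ Finset.range n, (Ico (s l) (s (l + 1))).indicator g x
      = (Ico (s 0) (s n)).indicator g x := by
  induction n with
  | zero => simp
  | succ n ih =>
    rw [Finset.sum_range_succ, ih, ← Ico_union_Ico_eq_Ico (hs (Nat.zero_le n)) (hs n.le_succ),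
      indicator_union_of_disjoint]
    rw [Set.disjoint_left]
    intro y h1 h2
    exact absurd h1.2 (not_lt.2 h2.1)

theorem IsDiracFlow.sum {w a b : ℕ → ℝ → ℂ} {s : ℕ → ℝ} (hs : Monotone s)
    (h : ∀ l, IsDiracFlow (w l) (a l) (b l))
    (hw : ∀ l x, x ∉ Ico (s l) (s (l + 1)) → w l x = 0) (n : ℕ) :
    IsDiracFlow (fun x => ∑ l ∈ Finset.range n, w l x)
      (fun x => (su11Prod (fun l => a l x) (fun l => b l x) n).1)
      (fun x => (su11Prod (fun l => a l x) (fun l => b l x) n).2) := by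
  induction n with
  | zero =>
    refine ⟨rfl, rfl, fun R _ => ?_, fun R _ => ?_, Eventually.of_forall fun x => ?_⟩
    · exact (LipschitzWith.const (1 : ℂ)).lipschitzOnWith.absolutelyContinuousOnInterval
    · exact (LipschitzWith.const (0 : ℂ)).lipschitzOnWith.absolutelyContinuousOnInterval
    · simpa [su11Prod] using ⟨hasDerivAt_const x (1 : ℂ), hasDerivAt_const x (0 : ℂ)⟩
  | succ n ih =>
    simp_rw [Finset.sum_range_succ]
    refine ih.mul (s := s n) (h n) (fun x hx => ?_) (fun x hx => ?_)
    · refine Finset.sum_eq_zero fun l hl => hw l x fun hx' => ?_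
      exact absurd hx'.2 (not_lt.2 ((hs (Finset.mem_range.1 hl)).trans hx))
    · exact hw n x fun hx' => absurd hx'.1 (not_le.2 hx)

/-- The value at `R` of the solution with potential `w`. -/
def flowValue (w : ℝ → ℂ) (R : ℝ) : ℂ × ℂ :=
  open Classical in
  -- The default is the first column of the identity; it is never met for integrable potentials,
  -- which have a solution.
  if h : ∃ P : (ℝ → ℂ) × (ℝ → ℂ), IsDiracFlow w P.1 P.2 then (h.choose.1 R, h.choose.2 R) else (1, 0)

theorem IsDiracFlow.flowValue_eq {w a b : ℝ → ℂ} (h : IsDiracFlow w a b) {R : ℝ} (hR : 0 ≤ R) :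
    flowValue w R = (a R, b R) := by
  have hex : ∃ P : (ℝ → ℂ) × (ℝ → ℂ), IsDiracFlow w P.1 P.2 := ⟨(a, b), h⟩
  rw [flowValue, dif_pos hex]
  have := hex.choose_spec.unique h hR
  rw [this.1, this.2]

variable {d : ℕ} {f : ℝ → ℂ}

/-- The potential `f * E_d (·, m d ^ (-k))` restricted to the `n`-th interval of length `d ^ k`. -/
def cellPotential (d : ℕ) (f : ℝ → ℂ) (k : ℤ) (n m : ℕ) : ℝ → ℂ :=
  (Ico ((n : ℝ) * (d : ℝ) ^ k) (((n + 1 : ℕ) : ℝ) * (d : ℝ) ^ k)).indicator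
    fun x => f x * cantorChar d x ((m : ℝ) * (d : ℝ) ^ (-k))

theorem integrableOn_mul_cantorChar (hd : 2 ≤ d) (hf : IntegrableOn f (Ici 0)) (ξ : ℝ) :
    IntegrableOn (fun x => f x * cantorChar d x ξ) (Ici 0) :=
  hf.mul_bdd (c := 1) (measurable_cantorChar hd ξ).aestronglyMeasurable
    (Eventually.of_forall fun x => (norm_cantorChar hd x ξ).le)

theorem cell_subset_Ici (d : ℕ) (k : ℤ) (n : ℕ) :
    Ico ((n : ℝ) * (d : ℝ) ^ k) (((n + 1 : ℕ) : ℝ) * (d : ℝ) ^ k) ⊆ Ici 0 :=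
  fun x hx => le_trans (by positivity) hx.1

theorem integrable_cellPotential (hd : 2 ≤ d) (hf : IntegrableOn f (Ici 0)) (k : ℤ) (n m : ℕ) :
    Integrable (cellPotential d f k n m) :=
  (integrable_indicator_iff measurableSet_Ico).2
    ((integrableOn_mul_cantorChar hd hf _).mono_set (cell_subset_Ici d k n))

theorem exists_isDiracFlow_cellPotential (hd : 2 ≤ d) (hf : IntegrableOn f (Ici 0)) (k : ℤ)
    (n m : ℕ) : ∃ a b, IsDiracFlow (cellPotential d f k n m) a b ∧ ∀ R, 0 ≤ R →
      flowValue (cellPotential d f k n m) R = (a R, b R) := by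
  obtain ⟨a, b, h, -⟩ := exists_isDiracFlow (integrable_cellPotential hd hf k n m)
  exact ⟨a, b, h, fun R hR => h.flowValue_eq hR⟩

theorem norm_sq_flowValue_cellPotential (hd : 2 ≤ d) (hf : IntegrableOn f (Ici 0)) (k : ℤ)
    (n m : ℕ) {R : ℝ} (hR : 0 ≤ R) :
    ‖(flowValue (cellPotential d f k n m) R).1‖ ^ 2
      - ‖(flowValue (cellPotential d f k n m) R).2‖ ^ 2 = 1 := by
  obtain ⟨a, b, h, e⟩ := exists_isDiracFlow_cellPotential hd hf k n m
  rw [e R hR]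
  exact h.det_eq_one hR

theorem monotone_cell (d : ℕ) (n : ℕ) (k : ℤ) :
    Monotone fun l : ℕ => ((d * n + l : ℕ) : ℝ) * (d : ℝ) ^ k := by
  intro l l' hl
  have : (0 : ℝ) ≤ (d : ℝ) ^ k := by positivity
  simp only
  gcongr

theorem Ico_parent_eq (hd : 2 ≤ d) (n : ℕ) (k : ℤ) :
    Ico ((n : ℝ) * (d : ℝ) ^ (k + 1)) (((n + 1 : ℕ) : ℝ) * (d : ℝ) ^ (k + 1)) =
      Ico (((d * n + 0 : ℕ) : ℝ) * (d : ℝ) ^ k) (((d * n + d : ℕ) : ℝ) * (d : ℝ) ^ k) := by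
  have hd0 : (d : ℝ) ≠ 0 := by positivity
  rw [zpow_add_one₀ hd0]
  congr 1
  · push_cast; ring
  · push_cast; ring

theorem cellPotential_child (hd : 2 ≤ d) (k : ℤ) (n m j : ℕ) (hj : j < d) (x : ℝ) :
    cellPotential d f (k + 1) n (d * m + j) x =
      ∑ l ∈ Finset.range d, (rootOfUnity d ^ j) ^ l * cellPotential d f k (d * n + l) m x := by
  rw [cellPotential, Ico_parent_eq hd, ← sum_indicator_Ico (monotone_cell d n k)]
  refine Finset.sum_congr rfl fun l hl => ?_
  rw [cellPotential, add_assoc]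
  by_cases hx : x ∈ Ico (((d * n + l : ℕ) : ℝ) * (d : ℝ) ^ k)
      (((d * n + (l + 1) : ℕ) : ℝ) * (d : ℝ) ^ k)
  · rw [indicator_of_mem hx, indicator_of_mem hx,
      cantorChar_child hd (Finset.mem_range.1 hl) m j hj hx.1 hx.2]
    ring
  · rw [indicator_of_notMem hx, indicator_of_notMem hx, mul_zero]

/-- On each subinterval the refined potential is a constant rotation of the coarse one, which
rotates `b` and fixes `a`; consecutive pieces multiply. Reading all flows at one common `R` avoids
tracking endpoints. -/
theorem flowValue_child (hd : 2 ≤ d) (hf : IntegrableOn f (Ici 0)) (k : ℤ) (n m j : ℕ) (hj : j < d)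
    {R : ℝ} (hR : 0 ≤ R) :
    flowValue (cellPotential d f (k + 1) n (d * m + j)) R =
      su11Prod (fun l => (flowValue (cellPotential d f k (d * n + l) m) R).1)
        (fun l => (rootOfUnity d ^ j) ^ l * (flowValue (cellPotential d f k (d * n + l) m) R).2) d := by
  choose a b h e using fun l => exists_isDiracFlow_cellPotential hd hf k (d * n + l) m
  have hn : ∀ l, ‖(rootOfUnity d ^ j) ^ l‖ = 1 := fun l => by
    rw [norm_pow, norm_pow, (isPrimitiveRoot_rootOfUnity hd).norm'_eq_one (by omega), one_pow,
      one_pow]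
  have hs := IsDiracFlow.sum (monotone_cell d n k) (fun l => (h l).const_mul (hn l))
    (fun l x hx => by
      rw [cellPotential, indicator_of_notMem, mul_zero]
      exact hx) d
  simp_rw [← cellPotential_child hd k n m j hj] at hs
  rw [hs.flowValue_eq hR]
  simp only [e _ R hR]

/-- The size of the scattering data of a tile. -/
def tileSize (c : ℝ) (d : ℕ) (f : ℝ → ℂ) (R : ℝ) (k : ℤ) (n m : ℕ) : ℝ :=
  Real.sqrt (Real.log (1 + c * ‖(flowValue (cellPotential d f k n m) R).2‖ ^ 2))

theorem sum_tileSize_child_le (hd : 2 ≤ d) {c : ℝ} (hc : 1 ≤ c)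
    (hloc : NodeInequality d c)
    (hf : IntegrableOn f (Ici 0)) {p q : ℝ}
    (hpq : p.HolderConjugate q) (hp : p ≤ 2) {R : ℝ} (hR : 0 ≤ R) (k : ℤ) (n m : ℕ) :
    ∑ j ∈ Finset.range d, tileSize c d f R (k + 1) n (d * m + j) ^ q
      ≤ d * (∑ l ∈ Finset.range d, tileSize c d f R k (d * n + l) m ^ p) ^ (q / p) := by
  have hlog : ∀ x : ℝ, 0 ≤ Real.log (1 + c * x ^ 2) := fun x =>
    Real.log_nonneg (by nlinarith [sq_nonneg x])
  have hsq : ∀ k n m, tileSize c d f R k n m ^ 2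
      = Real.log (1 + c * ‖(flowValue (cellPotential d f k n m) R).2‖ ^ 2) := fun k n m =>
    Real.sq_sqrt (hlog _)
  obtain ⟨γ, h1, h2⟩ := hloc (fun l => (flowValue (cellPotential d f k (d * n + l) m) R).1)
    (fun l => (flowValue (cellPotential d f k (d * n + l) m) R).2)
    (fun l => norm_sq_flowValue_cellPotential hd hf k _ m hR)
  refine sum_rpow_le_of_sq_le (isPrimitiveRoot_rootOfUnity hd) hpq hp (γ := γ)
    (fun j => Real.sqrt_nonneg _) (fun l _ => Real.sqrt_nonneg _) (fun l hl => ?_) (fun j hj => ?_)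
  · rw [hsq]
    exact h1 l hl
  · simp_rw [hsq]
    rw [flowValue_child hd hf k n m j hj hR]
    have := h2 (rootOfUnity d ^ j) (by
      rw [norm_pow, (isPrimitiveRoot_rootOfUnity hd).norm'_eq_one (by omega), one_pow])
    simpa only [pow_mul] using this

/-- The logarithm tames the exponential growth: `4m ≤ 4 + m²` turns `exp (4m)` into `exp 4 * exp
(m²)`, so a quadratic bound holds for small and large `m` alike. -/
theorem log_one_add_mul_sq_le {c B m : ℝ} (hc : 0 ≤ c) (hB : 0 ≤ B)
    (h : B ≤ 2 * Real.exp (2 * m) * m) :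
    Real.log (1 + c * B ^ 2) ≤ (4 * c * Real.exp 4 + 1) * m ^ 2 := by
  have h1 : B ^ 2 ≤ 4 * Real.exp (4 * m) * m ^ 2 := by
    calc B ^ 2 ≤ (2 * Real.exp (2 * m) * m) ^ 2 := pow_le_pow_left₀ hB h 2
      _ = 4 * (Real.exp (2 * m)) ^ 2 * m ^ 2 := by ring
      _ = _ := by
        rw [← Real.exp_nat_mul]
        congr 3
        push_cast
        ring
  have h2 : Real.exp (4 * m) ≤ Real.exp 4 * Real.exp (m ^ 2) := by
    rw [← Real.exp_add]
    exact Real.exp_le_exp.2 (by nlinarith [sq_nonneg (m - 2)])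
  have h3 : 1 + c * B ^ 2 ≤ Real.exp ((4 * c * Real.exp 4 + 1) * m ^ 2) := by
    have h4 : 1 ≤ Real.exp (m ^ 2) := Real.one_le_exp (sq_nonneg _)
    calc 1 + c * B ^ 2 ≤ 1 + c * (4 * (Real.exp 4 * Real.exp (m ^ 2)) * m ^ 2) := by
          gcongr
          exact h1.trans (by gcongr)
      _ ≤ (4 * c * Real.exp 4 * m ^ 2 + 1) * Real.exp (m ^ 2) := by nlinarith
      _ ≤ Real.exp (4 * c * Real.exp 4 * m ^ 2) * Real.exp (m ^ 2) := by
          gcongr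
          exact Real.add_one_le_exp _
      _ = _ := by rw [← Real.exp_add]; congr 1; ring
  calc _ ≤ Real.log (Real.exp ((4 * c * Real.exp 4 + 1) * m ^ 2)) :=
        Real.log_le_log (by positivity) h3
    _ = _ := Real.log_exp _

/-- Used at both ends: as the base of the tree induction and as the endpoint `q = ∞`. -/
theorem tileSize_le_integral (hd : 2 ≤ d) {c : ℝ} (hc : 1 ≤ c) (hf : IntegrableOn f (Ici 0))
    {R : ℝ} (hR : 0 ≤ R) (k : ℤ) (n m : ℕ) :
    tileSize c d f R k n m ≤ Real.sqrt (4 * c * Real.exp 4 + 1) *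
      ∫ x in Ico ((n : ℝ) * (d : ℝ) ^ k) (((n + 1 : ℕ) : ℝ) * (d : ℝ) ^ k), ‖f x‖ := by
  have hw := integrable_cellPotential hd hf k n m
  obtain ⟨a, b, h, hb⟩ := exists_isDiracFlow hw
  have hmass : ∫ t in (0 : ℝ)..R, ‖cellPotential d f k n m t‖ ≤
      ∫ x in Ico ((n : ℝ) * (d : ℝ) ^ k) (((n + 1 : ℕ) : ℝ) * (d : ℝ) ^ k), ‖f x‖ := by
    rw [intervalIntegral.integral_of_le hR]
    refine (setIntegral_le_integral hw.norm (Eventually.of_forall fun _ => norm_nonneg _)).trans_eq ?_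
    rw [← integral_indicator measurableSet_Ico]
    congr 1
    funext x
    rw [cellPotential, norm_indicator_eq_indicator_norm]
    congr 1
    funext y
    rw [norm_mul, norm_cantorChar hd, mul_one]
  have hm0 : 0 ≤ ∫ t in (0 : ℝ)..R, ‖cellPotential d f k n m t‖ :=
    intervalIntegral.integral_nonneg hR fun _ _ => norm_nonneg _
  rw [tileSize, h.flowValue_eq hR]
  refine Real.sqrt_le_iff.2 ⟨mul_nonneg (Real.sqrt_nonneg _) (hm0.trans hmass), ?_⟩
  rw [mul_pow, Real.sq_sqrt (by positivity)]
  refine log_one_add_mul_sq_le (by linarith) (norm_nonneg _) ((hb R hR).trans ?_)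
  gcongr

end Cells

/-! ### From the tree to the Lebesgue norms. -/

section GlobalEstimate

theorem rpow_setIntegral_norm_le {f : ℝ → ℂ} {p q : ℝ} (hpq : p.HolderConjugate q) {u v : ℝ}
    (huv : u ≤ v) (hf : MemLp f (ENNReal.ofReal p) (volume.restrict (Ico u v))) :
    (∫ x in Ico u v, ‖f x‖) ^ p ≤ (v - u) ^ (p / q) * ∫ x in Ico u v, ‖f x‖ ^ p := by
  have h := integral_mul_le_Lp_mul_Lq_of_nonneg (μ := volume.restrict (Ico u v)) hpq
    (f := fun x => ‖f x‖) (g := fun _ => (1 : ℝ)) (Eventually.of_forall fun _ => norm_nonneg _)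
    (Eventually.of_forall fun _ => zero_le_one) hf.norm (memLp_const 1)
  simp only [mul_one, Real.one_rpow, integral_const, smul_eq_mul, measureReal_restrict_apply_univ,
    Real.volume_real_Ico_of_le huv] at h
  have hI : 0 ≤ ∫ x in Ico u v, ‖f x‖ ^ p := integral_nonneg fun _ => by positivity
  refine (Real.rpow_le_rpow (integral_nonneg fun _ => norm_nonneg _) h hpq.pos.le).trans_eq ?_
  have hvu : 0 ≤ v - u := sub_nonneg.2 huv
  rw [Real.mul_rpow (by positivity) (by positivity), ← Real.rpow_mul hI, ← Real.rpow_mul hvu,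
    one_div_mul_cancel hpq.pos.ne', Real.rpow_one, one_div_mul_eq_div, mul_comm]

variable {d : ℕ} {f : ℝ → ℂ}

/-- The climb starts from intervals of length `d ^ (-N)` at frequency zero and takes `N + K`
generations to reach `[0, d ^ K)`, with frequencies in `[0, d ^ N)`. Hölder's factor `d ^ (-N p /
q)` at the base leaves only `d ^ (K p / q)` of the tree's growth, which the length `d ^ (-K)` of a
frequency cell compensates; hence no `N` on the right. -/
theorem sum_tileSize_rpow_le (hd : 2 ≤ d) {c : ℝ} (hc : 1 ≤ c)
    (hloc : NodeInequality d c)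
    (hf : IntegrableOn f (Ici 0)) {p q : ℝ}
    (hpq : p.HolderConjugate q) (hp : p ≤ 2)
    (hfp : MemLp f (ENNReal.ofReal p) (volume.restrict (Ici 0))) {R : ℝ} (hR : 0 ≤ R) (N K : ℕ) :
    (∑ m ∈ Finset.range (d ^ (N + K)), tileSize c d f R K 0 m ^ q) * ((d : ℝ) ^ K)⁻¹ ≤
      (Real.sqrt (4 * c * Real.exp 4 + 1) * (∫ x in Ici 0, ‖f x‖ ^ p) ^ p⁻¹) ^ q := by
  set C : ℝ := Real.sqrt (4 * c * Real.exp 4 + 1) with hC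
  have hC0 : 0 ≤ C := Real.sqrt_nonneg _
  have hd0 : (0 : ℝ) < d := by positivity
  have hp0 : 0 < p := hpq.pos
  have hq0 : 0 < q := hpq.symm.pos
  have hint : IntegrableOn (fun x => ‖f x‖ ^ p) (Ici 0) := by
    have := hfp.integrable_norm_rpow (by simpa using hp0) (by simp)
    rwa [ENNReal.toReal_ofReal hp0.le] at this
  let cell : ℕ → ℕ → Set ℝ := fun i n =>
    Ico ((n : ℝ) * (d : ℝ) ^ ((i : ℤ) - N)) (((n + 1 : ℕ) : ℝ) * (d : ℝ) ^ ((i : ℤ) - N))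
  have hcell : ∀ i n, cell i n ⊆ Ici 0 := fun i n => cell_subset_Ici d _ n
  let J : ℕ → ℕ → ℝ := fun i n => C ^ p * (((d : ℝ) ^ N)⁻¹ ^ (p / q) * ∫ x in cell i n, ‖f x‖ ^ p)
  have hJ : ∀ i n, ∑ l ∈ Finset.range d, J i (d * n + l) ≤ J (i + 1) n := by
    intro i n
    simp only [J]
    rw [← Finset.mul_sum, ← Finset.mul_sum]
    refine le_of_eq ?_
    congr 2
    have e : ((i + 1 : ℕ) : ℤ) - N = ((i : ℤ) - N) + 1 := by push_cast; ring
    simp only [cell]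
    rw [e, Ico_parent_eq hd, ← integral_indicator measurableSet_Ico]
    simp_rw [← sum_indicator_Ico (monotone_cell d n ((i : ℤ) - N))]
    rw [integral_finsetSum]
    · refine Finset.sum_congr rfl fun l _ => ?_
      rw [integral_indicator measurableSet_Ico]
      rfl
    · intro l _
      exact (integrable_indicator_iff measurableSet_Ico).2
        (hint.mono_set (hcell i (d * n + l)))
  have hbase : ∀ n, tileSize c d f R (((0 : ℕ) : ℤ) - N) n 0 ^ p ≤ J 0 n := by
    intro n
    have h1 := tileSize_le_integral hd hc hf hR (((0 : ℕ) : ℤ) - N) n 0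
    have hlen : ((n : ℝ) * (d : ℝ) ^ (((0 : ℕ) : ℤ) - N)) ≤
        (((n + 1 : ℕ) : ℝ) * (d : ℝ) ^ (((0 : ℕ) : ℤ) - N)) := by
      have : (0 : ℝ) ≤ (d : ℝ) ^ (((0 : ℕ) : ℤ) - N) := by positivity
      gcongr
      omega
    have h2 := rpow_setIntegral_norm_le hpq hlen
      (hfp.mono_measure (Measure.restrict_mono (hcell 0 n) le_rfl))
    have e : (((n + 1 : ℕ) : ℝ) * (d : ℝ) ^ (((0 : ℕ) : ℤ) - N))
        - ((n : ℝ) * (d : ℝ) ^ (((0 : ℕ) : ℤ) - N)) = ((d : ℝ) ^ N)⁻¹ := by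
      rw [← sub_mul]
      push_cast
      rw [add_sub_cancel_left, one_mul, zero_sub, zpow_neg, zpow_natCast]
    rw [e] at h2
    calc _ ≤ (C * ∫ x in cell 0 n, ‖f x‖) ^ p :=
          Real.rpow_le_rpow (Real.sqrt_nonneg _) h1 hp0.le
      _ = C ^ p * (∫ x in cell 0 n, ‖f x‖) ^ p :=
          Real.mul_rpow hC0 (integral_nonneg fun _ => norm_nonneg _)
      _ ≤ J 0 n := by
          simp only [J]
          gcongr
  have hnode : ∀ i n m, ∑ j ∈ Finset.range d,
      tileSize c d f R (((i + 1 : ℕ) : ℤ) - N) n (d * m + j) ^ q ≤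
      d * (∑ l ∈ Finset.range d, tileSize c d f R ((i : ℤ) - N) (d * n + l) m ^ p) ^ (q / p) := by
    intro i n m
    have e : ((i + 1 : ℕ) : ℤ) - N = ((i : ℤ) - N) + 1 := by push_cast; ring
    rw [e]
    exact sum_tileSize_child_le hd hc hloc hf hpq hp hR _ n m
  have main := sum_rpow_le_of_forall_node hpq hp
    (F := fun i n m => tileSize c d f R ((i : ℤ) - N) n m) (fun _ _ _ => Real.sqrt_nonneg _) hnode
    hJ hbase (N + K) 0
  have eK : ((N + K : ℕ) : ℤ) - N = K := by push_cast; ring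
  simp only [J, eK] at main
  set S := ∑ m ∈ Finset.range (d ^ (N + K)), tileSize c d f R K 0 m ^ q with hS
  have hS0 : 0 ≤ S := Finset.sum_nonneg fun m _ => Real.rpow_nonneg (Real.sqrt_nonneg _) _
  set I := ∫ x in Ici 0, ‖f x‖ ^ p with hI
  have hI0 : 0 ≤ I := integral_nonneg fun _ => by positivity
  have hle : ∫ x in cell (N + K) 0, ‖f x‖ ^ p ≤ I :=
    setIntegral_mono_set hint (Eventually.of_forall fun _ => by positivity)
      (hcell _ _).eventuallyLE
  have h3 : S ^ (p / q) ≤ ((d : ℝ) ^ K) ^ (p / q) * (C ^ p * I) := by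
    refine main.trans ?_
    have : ((d : ℝ) ^ (N + K)) ^ (p / q) * ((d : ℝ) ^ N)⁻¹ ^ (p / q) = ((d : ℝ) ^ K) ^ (p / q) := by
      rw [← Real.mul_rpow (by positivity) (by positivity)]
      congr 1
      rw [pow_add]
      field_simp
    calc _ = (((d : ℝ) ^ (N + K)) ^ (p / q) * ((d : ℝ) ^ N)⁻¹ ^ (p / q)) *
          (C ^ p * ∫ x in cell (N + K) 0, ‖f x‖ ^ p) := by ring
      _ ≤ _ := by
        rw [this]
        gcongr
  have h4 := Real.rpow_le_rpow (by positivity) h3 (by positivity : 0 ≤ q / p)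
  have hpq1 : p / q * (q / p) = 1 := by field_simp
  rw [← Real.rpow_mul hS0, hpq1, Real.rpow_one, Real.mul_rpow (by positivity) (by positivity),
    ← Real.rpow_mul (by positivity), hpq1, Real.rpow_one] at h4
  rw [← div_eq_mul_inv, div_le_iff₀' (by positivity)]
  refine h4.trans_eq ?_
  congr 1
  rw [Real.mul_rpow (by positivity) hI0, Real.mul_rpow hC0 (by positivity), ← Real.rpow_mul hC0,
    ← Real.rpow_mul hI0, mul_div_cancel₀ _ hp0.ne', inv_mul_eq_div]

theorem setLIntegral_comp_floor {D : ℝ} (hD : 0 < D) (H : ℕ → ℝ≥0∞) (M : ℕ) :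
    ∫⁻ ξ in Ico 0 ((M : ℝ) * D⁻¹), H ⌊ξ * D⌋₊
      = (∑ m ∈ Finset.range M, H m) * ENNReal.ofReal D⁻¹ := by
  have hs : Monotone fun m : ℕ => (m : ℝ) * D⁻¹ := by
    intro a b hab
    simp only
    gcongr
  have hmeas : Measurable fun ξ : ℝ => H ⌊ξ * D⌋₊ :=
    (measurable_from_nat (f := H)).comp (Nat.measurable_floor.comp (measurable_id.mul_const _))
  have h0 : (0 : ℝ) = ((0 : ℕ) : ℝ) * D⁻¹ := by simp
  rw [h0, ← lintegral_indicator measurableSet_Ico]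
  simp_rw [← sum_indicator_Ico hs]
  rw [lintegral_finsetSum _ fun m _ => hmeas.indicator measurableSet_Ico, Finset.sum_mul]
  refine Finset.sum_congr rfl fun m _ => ?_
  rw [lintegral_indicator measurableSet_Ico, setLIntegral_congr_fun (g := fun _ => H m)
    measurableSet_Ico, setLIntegral_const, Real.volume_Ico]
  · congr 2
    push_cast
    ring
  · intro ξ hξ
    have h1 := hξ.1
    have h2 := hξ.2
    rw [← div_eq_mul_inv, div_le_iff₀ hD] at h1
    rw [← div_eq_mul_inv, lt_div_iff₀ hD] at h2
    have : ⌊ξ * D⌋₊ = m := (Nat.floor_eq_iff (le_trans (Nat.cast_nonneg m) h1)).2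
      ⟨h1, by exact_mod_cast h2⟩
    simp only [this]

/-- The scattering data only depend on the cell of the frequency. -/
theorem IsDiracFlow.cell_of_mul_cantorChar (hd : 2 ≤ d) {K : ℕ}
    (hK : ∀ x, (d : ℝ) ^ K ≤ x → f x = 0) {ξ : ℝ} {a b : ℝ → ℂ}
    (h : IsDiracFlow (fun x => f x * cantorChar d x ξ) a b) :
    IsDiracFlow (cellPotential d f K 0 ⌊ξ * (d : ℝ) ^ K⌋₊) a b := by
  refine h.congr_ae ?_
  filter_upwards [ae_restrict_mem measurableSet_Ici] with x hx
  rw [cellPotential]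
  rcases lt_or_ge x ((d : ℝ) ^ K) with hxK | hxK
  · rw [indicator_of_mem, cantorChar_floor hd hxK]
    refine ⟨by simpa using hx, by simpa using hxK⟩
  · rw [indicator_of_notMem, hK x hxK, zero_mul]
    intro hx'
    have := hx'.2
    simp only [zero_add, Nat.cast_one, one_mul, zpow_natCast] at this
    linarith

theorem IsDiracFlow.eventually_eq {w a b : ℝ → ℂ} (h : IsDiracFlow w a b) {R : ℝ} (hR : 0 ≤ R)
    (hw : ∀ x, R ≤ x → w x = 0) :
    ∀ᶠ x in atTop, su11Matrix (a x) (b x) = su11Matrix (a R) (b R) := by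
  filter_upwards [eventually_ge_atTop R] with x hx
  obtain ⟨h1, h2⟩ := h.eq_of_eq_zero_on hR hx (fun y hy _ => hw y hy)
  rw [h1, h2]

theorem exists_scattering (hd : 2 ≤ d) (hf : IsCompactlySupportedIntegrable f) (ξ : ℝ) :
    ∃ G ∈ SU11, IsScatteringTransformAt d f ξ G ∧
      ∀ G' : Matrix (Fin 2) (Fin 2) ℂ, IsScatteringTransformAt d f ξ G' → G' = G := by
  obtain ⟨R₀, hR₀⟩ := hf.compactSupport
  set R := max R₀ 0
  have hR0 : 0 ≤ R := le_max_right _ _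
  have hw : ∀ x, R ≤ x → f x * cantorChar d x ξ = 0 := fun x hx => by
    rw [hR₀ x ((le_max_left _ _).trans hx), zero_mul]
  -- Nothing is assumed of `f` on the negative axis, so the potential is cut off there before
  -- solving.
  have hint := (integrable_indicator_iff measurableSet_Ici).2
    (integrableOn_mul_cantorChar hd hf.integrableOn ξ)
  obtain ⟨a, b, h, -⟩ := exists_isDiracFlow hint
  have h' : IsDiracFlow (fun x => f x * cantorChar d x ξ) a b := by
    refine h.congr_ae ?_
    filter_upwards [ae_restrict_mem measurableSet_Ici] with x hx using indicator_of_mem hx _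
  refine ⟨su11Matrix (a R) (b R), ⟨a R, b R, h'.det_eq_one hR0, rfl⟩,
    ⟨a, b, isDiracSolution_iff.2 h', ?_⟩, ?_⟩
  · exact tendsto_const_nhds.congr' ((h'.eventually_eq hR0 hw).mono fun x hx => hx.symm)
  · rintro G' ⟨a', b', h1, h2⟩
    have h1' := isDiracSolution_iff.1 h1
    have h3 := tendsto_nhds_unique h2
      (tendsto_const_nhds.congr' ((h1'.eventually_eq hR0 hw).mono fun x hx => hx.symm))
    obtain ⟨e1, e2⟩ := h1'.unique h' hR0
    rw [h3, e1, e2]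

theorem IsScatteringTransformAt.apply_zero_zero (hd : 2 ≤ d) {K : ℕ}
    (hK : ∀ x, (d : ℝ) ^ K ≤ x → f x = 0) {ξ : ℝ} {G : Matrix (Fin 2) (Fin 2) ℂ}
    (h : IsScatteringTransformAt d f ξ G) :
    G 0 0 = (flowValue (cellPotential d f K 0 ⌊ξ * (d : ℝ) ^ K⌋₊) ((d : ℝ) ^ K)).1 := by
  obtain ⟨a, b, h1, h2⟩ := h
  have h1' := isDiracSolution_iff.1 h1
  have hR0 : (0 : ℝ) ≤ (d : ℝ) ^ K := by positivity
  have h3 := tendsto_nhds_unique h2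
    (tendsto_const_nhds.congr' ((h1'.eventually_eq hR0 (fun x hx => by
      rw [hK x hx, zero_mul])).mono fun x hx => hx.symm))
  rw [(h1'.cell_of_mul_cantorChar hd hK).flowValue_eq hR0, h3]
  rfl

/-- `|a| ≤ |a|² = 1 + |b|² ≤ 1 + c |b|²`. -/
theorem sqrt_log_le_tileSize (hd : 2 ≤ d) {c : ℝ} (hc : 1 ≤ c) (hf : IntegrableOn f (Ici 0)) {R : ℝ}
    (hR : 0 ≤ R) (k : ℤ) (n m : ℕ) :
    Real.sqrt (Real.log ‖(flowValue (cellPotential d f k n m) R).1‖) ≤ tileSize c d f R k n m := by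
  have h := norm_sq_flowValue_cellPotential hd hf k n m hR
  set a := (flowValue (cellPotential d f k n m) R).1
  set b := (flowValue (cellPotential d f k n m) R).2 with hb
  have ha : 1 ≤ ‖a‖ := by nlinarith [norm_nonneg a, sq_nonneg ‖b‖]
  refine Real.sqrt_le_sqrt (Real.log_le_log (by linarith) ?_)
  nlinarith [sq_nonneg ‖b‖]

end GlobalEstimate

end

/-! ### The theorem. -/

theorem theorem1 (d : ℕ) (hd : 2 ≤ d) :
    (∀ f : ℝ → ℂ, IsCompactlySupportedIntegrable f → ∀ ξ : ℝ, 0 ≤ ξ →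
      ∃ G ∈ SU11, IsScatteringTransformAt d f ξ G ∧
        ∀ G' : Matrix (Fin 2) (Fin 2) ℂ, IsScatteringTransformAt d f ξ G' → G' = G) ∧
    ∃ C : ℝ, 0 < C ∧
      ∀ p q : ℝ≥0∞, 1 ≤ p → p ≤ 2 → 2 ≤ q → ENNReal.HolderConjugate p q →
      ∀ f : ℝ → ℂ, IsCompactlySupportedIntegrable f →
      ∀ G : ℝ → Matrix (Fin 2) (Fin 2) ℂ,
        (∀ ξ : ℝ, 0 ≤ ξ → IsScatteringTransformAt d f ξ (G ξ)) →
        AEStronglyMeasurable (fun ξ => Real.sqrt (Real.log ‖G ξ 0 0‖))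
          (volume.restrict (Ici (0 : ℝ))) ∧
        eLpNorm (fun ξ => Real.sqrt (Real.log ‖G ξ 0 0‖)) q (volume.restrict (Ici (0 : ℝ)))
          ≤ ENNReal.ofReal C * eLpNorm f p (volume.restrict (Ici (0 : ℝ))) := by
  refine ⟨fun f hf ξ _ => exists_scattering hd hf ξ, ?_⟩
  obtain ⟨c, hc, hloc⟩ := exists_nodeInequality d
  have hd0 : (0 : ℝ) < d := by positivity
  have hd1 : (1 : ℝ) < d := by exact_mod_cast hd
  refine ⟨Real.sqrt (4 * c * Real.exp 4 + 1), Real.sqrt_pos.2 (by positivity), ?_⟩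
  intro p q hp1 hp2 hq2 hpq f hf G hG
  set C := Real.sqrt (4 * c * Real.exp 4 + 1)
  have hC0 : 0 ≤ C := Real.sqrt_nonneg _
  obtain ⟨R₀, hR₀⟩ := hf.compactSupport
  obtain ⟨K, hK⟩ := pow_unbounded_of_one_lt R₀ hd1
  have hfK : ∀ x, (d : ℝ) ^ K ≤ x → f x = 0 := fun x hx => hR₀ x (hK.le.trans hx)
  have hR : (0 : ℝ) ≤ (d : ℝ) ^ K := by positivity
  have hDpos : (0 : ℝ) < (d : ℝ) ^ K := by positivity
  set g : ℝ → ℝ := fun ξ => Real.sqrt (Real.log ‖G ξ 0 0‖) with hg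
  set y : ℕ → ℝ := fun m =>
    Real.sqrt (Real.log ‖(flowValue (cellPotential d f K 0 m) ((d : ℝ) ^ K)).1‖) with hy
  -- Since `f` vanishes beyond `d ^ K`, the transform is constant on frequency cells of length `d ^
  -- (-K)`. This gives measurability and turns the norm into a sum.
  have hgy : ∀ ξ, 0 ≤ ξ → g ξ = y ⌊ξ * (d : ℝ) ^ K⌋₊ := fun ξ hξ => by
    simp only [hg, hy]
    rw [(hG ξ hξ).apply_zero_zero hd hfK]
  have hgae : g =ᵐ[volume.restrict (Ici (0 : ℝ))] fun ξ => y ⌊ξ * (d : ℝ) ^ K⌋₊ := by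
    filter_upwards [ae_restrict_mem measurableSet_Ici] with ξ hξ using hgy ξ hξ
  have hmeas : Measurable fun ξ : ℝ => y ⌊ξ * (d : ℝ) ^ K⌋₊ :=
    (measurable_from_nat (f := y)).comp (Nat.measurable_floor.comp (measurable_id.mul_const _))
  refine ⟨⟨_, hmeas.stronglyMeasurable, hgae⟩, ?_⟩
  rw [eLpNorm_congr_ae hgae]
  have hyt : ∀ m, y m ≤ tileSize c d f ((d : ℝ) ^ K) K 0 m := fun m =>
    sqrt_log_le_tileSize hd hc hf.integrableOn hR K 0 m
  have hy0 : ∀ m, 0 ≤ y m := fun m => Real.sqrt_nonneg _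
  rcases eq_or_ne q ∞ with rfl | hq
  · have hp : p = 1 := by
      have := hpq.inv_add_inv_eq_one
      simpa using this
    subst hp
    rw [eLpNorm_exponent_top, eLpNorm_one_eq_lintegral_enorm]
    refine eLpNormEssSup_le_of_ae_enorm_bound (Eventually.of_forall fun ξ => ?_)
    rw [Real.enorm_of_nonneg (hy0 _), ← ofReal_integral_norm_eq_lintegral_enorm hf.integrableOn,
      ← ENNReal.ofReal_mul hC0]
    refine ENNReal.ofReal_le_ofReal (((hyt _).trans
      (tileSize_le_integral hd hc hf.integrableOn hR K 0 _)).trans ?_)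
    exact mul_le_mul_of_nonneg_left (setIntegral_mono_set hf.integrableOn.norm
      (Eventually.of_forall fun _ => norm_nonneg _) (cell_subset_Ici d K 0).eventuallyLE) hC0
  · by_cases hfp : eLpNorm f p (volume.restrict (Ici (0 : ℝ))) = ∞
    -- An infinite Lᵖ norm makes the bound trivial because the constant is positive.
    · rw [hfp, ENNReal.mul_top (by simpa using Real.sqrt_pos.2 (by positivity))]
      exact le_top
    have hpt : p ≠ ∞ := (hp2.trans_lt (by simp)).ne
    have hp0 : p ≠ 0 := (zero_lt_one.trans_le hp1).ne'
    have hq0 : q ≠ 0 := (zero_lt_two.trans_le hq2).ne'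
    have hfm : MemLp f p (volume.restrict (Ici (0 : ℝ))) :=
      ⟨hf.integrableOn.aestronglyMeasurable, lt_top_iff_ne_top.2 hfp⟩
    have hp2' : p.toReal ≤ 2 := by
      simpa using (ENNReal.toReal_le_toReal hpt (by simp)).2 hp2
    have hpq' : p.toReal.HolderConjugate q.toReal := by
      have h1 : 0 < p.toReal := ENNReal.toReal_pos hp0 hpt
      have h2 : 0 < q.toReal := ENNReal.toReal_pos hq0 hq
      refine ⟨?_, h1, h2⟩
      have := congrArg ENNReal.toReal hpq.inv_add_inv_eq_one
      rw [ENNReal.toReal_add (by simpa using hp0) (by simpa using hq0), ENNReal.toReal_inv,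
        ENNReal.toReal_inv] at this
      simpa using this
    have hq' : 0 < q.toReal := hpq'.symm.pos
    rw [eLpNorm_eq_lintegral_rpow_enorm_toReal hq0 hq, hfm.eLpNorm_eq_integral_rpow_norm hp0 hpt,
      ← ENNReal.ofReal_mul hC0, one_div]
    set B := C * (∫ x in Ici 0, ‖f x‖ ^ p.toReal) ^ p.toReal⁻¹ with hB
    have hB0 : 0 ≤ B := mul_nonneg hC0 (Real.rpow_nonneg (integral_nonneg fun _ => by positivity) _)
    rw [ENNReal.rpow_inv_le_iff hq', ENNReal.ofReal_rpow_of_nonneg hB0 hq'.le]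
    have hmono : Monotone fun N : ℕ => Ico (0 : ℝ) (((d ^ (N + K) : ℕ) : ℝ) * ((d : ℝ) ^ K)⁻¹) := by
      intro N M hNM
      refine Ico_subset_Ico_right ?_
      gcongr
      omega
    have hU : Ici (0 : ℝ) = ⋃ N : ℕ, Ico (0 : ℝ) (((d ^ (N + K) : ℕ) : ℝ) * ((d : ℝ) ^ K)⁻¹) := by
      ext ξ
      simp only [mem_Ici, mem_iUnion, mem_Ico]
      refine ⟨fun hξ => ?_, fun ⟨_, h, _⟩ => h⟩
      obtain ⟨N, hN⟩ := pow_unbounded_of_one_lt ξ hd1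
      refine ⟨N, hξ, ?_⟩
      push_cast
      rwa [pow_add, mul_inv_cancel_right₀ hDpos.ne']
    -- Monotone convergence over the frequency ranges `[0, d ^ N)`; the bound on each is independent
    -- of `N`.
    rw [hU, setLIntegral_iUnion_of_directed _ hmono.directed_le]
    refine iSup_le fun N => ?_
    rw [setLIntegral_comp_floor hDpos (fun m => ‖y m‖ₑ ^ q.toReal)]
    have hfp' : MemLp f (ENNReal.ofReal p.toReal) (volume.restrict (Ici (0 : ℝ))) := by
      rwa [ENNReal.ofReal_toReal hpt]
    have key := sum_tileSize_rpow_le hd hc hloc hf.integrableOn hpq' hp2' hfp' hR N K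
    calc _ ≤ (∑ m ∈ Finset.range (d ^ (N + K)),
          ENNReal.ofReal (tileSize c d f ((d : ℝ) ^ K) K 0 m ^ q.toReal)) *
          ENNReal.ofReal ((d : ℝ) ^ K)⁻¹ := by
          gcongr with m _
          rw [Real.enorm_of_nonneg (hy0 m), ENNReal.ofReal_rpow_of_nonneg (hy0 m) hq'.le]
          exact ENNReal.ofReal_le_ofReal (Real.rpow_le_rpow (hy0 m) (hyt m) hq'.le)
      _ = ENNReal.ofReal ((∑ m ∈ Finset.range (d ^ (N + K)),
          tileSize c d f ((d : ℝ) ^ K) K 0 m ^ q.toReal) * ((d : ℝ) ^ K)⁻¹) := by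
          have h0 : ∀ m ∈ Finset.range (d ^ (N + K)),
              0 ≤ tileSize c d f ((d : ℝ) ^ K) K 0 m ^ q.toReal := fun m _ =>
            Real.rpow_nonneg (Real.sqrt_nonneg _) _
          rw [← ENNReal.ofReal_sum_of_nonneg h0, ← ENNReal.ofReal_mul (Finset.sum_nonneg h0)]
      _ ≤ _ := ENNReal.ofReal_le_ofReal key
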